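/- **Setting.** $m$ features are examined in a primary study with $p$-values $P_1=(P_{11},\dots,P_{1m})$. Based on $P_1$, a random set $\mathcal R_1=\mathcal R_1(P_1)\subseteq\{1,\dots,m\}$, $R_1=|\mathcal R_1|$, is selected for a follow-up study with $p$-values $P_{2j}$; write $P_2=(P_{21},\dots,P_{2m})$, of which only the $P_{2j}$ with $j\in\mathcal R_1$ are used. All $p$-values lie in $(0,1]$ almost surely, and a $p$-value $P$ of a true null hypothesis satisfies $\Pr(P\le x)\le x$ for $x\in[0,1]$. Let $I_{00},I_{01},I_{10}$ be the sets of features that are null in both studies, null in the primary study only, and null in the follow-up study only, and let $f_{00}=|I_{00}|/m$. If $R$ features are declared replicated, $R_{ij}$ of them from $I_{ij}$, the FDR for replicability analysis is $E\big[(R_{00}+R_{01}+R_{10})/\max(R,1)\big]$. The selection rule is *stable* if for every $j\in\mathcal R_1$, fixing all primary study $p$-values except $p_{1j}$ and changing $p_{1j}$ so that $j$ is still selected does not change $\mathcal R_1$. $P_2$ is *PRDS* if for every feature $i$ that is null in the follow-up study and every (measurable) increasing set $D\subseteq\mathbb R^m$, $\Pr(P_2\in D\mid P_{2i}=x)$ is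 nondecreasing in $x$. **The $r$-values.** Let $l_{00}\in[0,1)$, $c_2\in(0,1)$ and, for $x\in(0,1)$, $c_1(x)=\frac{1-c_2}{1-l_{00}(1-c_2x)}$. For $j\in\mathcal R_1$ let $e_j(x)=\max\big(\frac{P_{1j}}{c_1(x)},\frac{R_1P_{2j}}{m\,c_2}\big)$, let $\mathrm{rank}(e_j)=|\{k\in\mathcal R_1:e_k\le e_j\}|$, and for $i\in\mathcal R_1$ let $$f_i(x)=\min_{j\in\mathcal R_1:\,e_j\ge e_i}\frac{e_j\,m}{\mathrm{rank}(e_j)} .$$ The $r$-value $r_i$ of $i\in\mathcal R_1$ is the solution of $f_i(r_i)=r_i$ in $(0,1)$ if there is one, and $1$ otherwise. **Theorem.** Suppose that the selection rule is stable, $l_{00}\le f_{00}$, the follow-up $p$-values $P_{21},\dots,P_{2m}$ are jointly independent or PRDS, and $P_2$ is independent of $P_1$. Then for every $q>0$ the procedure that declares as replicated all features $i\in\mathcal R_1$ with $r_i\le q$ has FDR for replicability analysis at most $q$ in each of the following situations. 1. The primary study $p$-values are independent. 2. The dependence among the primary study $p$-values is arbitrary, and in the computation of $e_j$ and $f_i$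 the number $m$ is replaced by $m^*=m\sum_{i=1}^m 1/i$. 3. The dependence among the primary study $p$-values is arbitrary, the primary study $p$-values of all selected features are at most a fixed $t\in(0,1)$, in the computation of $e_j$ the function $c_1(x)$ is replaced by $$\tilde c_1(x)=\max\Big\{a:\ a\Big(1+\sum_{i=1}^{\lceil tm/(ax)-1\rceil}\tfrac1i\Big)=c_1(x)\Big\},$$ and $r_i=\min\{x\in(0,1):f_i(x)\le x\}$ if there is such an $x$, and $r_i=1$ otherwise. Moreover, all of these quantities are well defined: in 1 and 2, almost surely for every $i\in\mathcal R_1$, the equation $f_i(x)=x$ has at most one solution in $(0,1)$; in 3 the maximum defining $\tilde c_1(x)$ exists for every $x\in(0,1)$, and almost surely for every $i\in\mathcal R_1$ the minimum defining $r_i$ exists whenever some $x\in(0,1)$ satisfies $f_i(x)\le x$. -/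

import Mathlib

open MeasureTheory ProbabilityTheory

noncomputable section

namespace Replicability

/-- Positive regression dependence on the subset `N` (PRDS): for every measurable increasing set `D`
and every `i ∈ N`, the conditional probability `Pr(P ∈ D | P i = x)` is nondecreasing in `x`, that is,
it has a version which is a nondecreasing function of the value of `P i`. -/
def PRDS {Ω : Type*} [MeasurableSpace Ω] (μ : Measure Ω) {m : ℕ} (P : Fin m → Ω → ℝ)
    (N : Finset (Fin m)) : Prop :=
  ∀ D : Set (Fin m → ℝ), MeasurableSet D → IsUpperSet D → ∀ i ∈ N,
    ∃ g : ℝ → ℝ, Monotone g ∧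
      μ[Set.indicator {ω | (fun k => P k ω) ∈ D} (fun _ => (1 : ℝ)) |
        MeasurableSpace.comap (P i) inferInstance] =ᵐ[μ] fun ω => g (P i ω)

/-- A valid `p`-value of a true null hypothesis: `Pr(X ≤ x) ≤ x` for `x ∈ [0,1]`. -/
def NullPValue {Ω : Type*} [MeasurableSpace Ω] (μ : Measure Ω) (X : Ω → ℝ) : Prop :=
  ∀ x ∈ Set.Icc (0 : ℝ) 1, μ {ω | X ω ≤ x} ≤ ENNReal.ofReal x

/-- The vectors of (positive) `p`-values. -/
def PVector (m : ℕ) : Set (Fin m → ℝ) := {p | ∀ i, p i ∈ Set.Ioc (0 : ℝ) 1}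

/-- Stable selection rule: changing the `p`-value of a selected `j` only, in such a way that `j` is
still selected, does not change the selected set. -/
def StableRule {m : ℕ} (S : (Fin m → ℝ) → Finset (Fin m)) : Prop :=
  ∀ p ∈ PVector m, ∀ j ∈ S p, ∀ x ∈ Set.Ioc (0 : ℝ) 1,
    j ∈ S (Function.update p j x) → S (Function.update p j x) = S p

/-- A selection rule is measurable if each event "`j` is selected" is. -/
def MeasurableRule {m : ℕ} (S : (Fin m → ℝ) → Finset (Fin m)) : Prop :=
  ∀ j, MeasurableSet {p : Fin m → ℝ | j ∈ S p}

/-- The constant `c₁(x)`. -/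
def c1 (l₀₀ c₂ x : ℝ) : ℝ := (1 - c₂) / (1 - l₀₀ * (1 - c₂ * x))

/-- The set of `a` with `a (1 + ∑_{i=1}^{⌈tm/(ax) - 1⌉} 1/i) = c₁(x)`. All its elements are
positive, since `c₁(x) > 0`. -/
def c1TildeSet (m : ℕ) (t l₀₀ c₂ x : ℝ) : Set ℝ :=
  {a | a * (1 + ∑ i ∈ Finset.Icc 1 ⌈t * m / (a * x) - 1⌉₊, 1 / (i : ℝ)) = c1 l₀₀ c₂ x}

/-- The modified constant: the largest element of `c1TildeSet`. -/
def c1Tilde (m : ℕ) (t l₀₀ c₂ x : ℝ) : ℝ := sSup (c1TildeSet m t l₀₀ c₂ x)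

/-- `m* = m ∑_{i=1}^m 1/i`. -/
def mStar (m : ℕ) : ℝ := m * ∑ i ∈ Finset.Icc 1 m, 1 / (i : ℝ)

/-- The `e`-values, for the selected set `S`; `M` stands for `m` or `m*`. -/
def eValue {m : ℕ} (M c₁ c₂ : ℝ) (S : Finset (Fin m)) (p₁ p₂ : Fin m → ℝ) (j : Fin m) : ℝ :=
  max (1 / c₁ * p₁ j) ((S.card : ℝ) / (M * c₂) * p₂ j)

/-- The rank of `e j` among the `e k`, `k ∈ S`, with maximum rank for ties. -/
def maxRank {m : ℕ} (S : Finset (Fin m)) (e : Fin m → ℝ) (j : Fin m) : ℕ :=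
  (S.filter fun k => e k ≤ e j).card

/-- The minimum of `e j * M / rank (e j)` over the `j ∈ S` with `e j ≥ e i`
(a finite set, which contains `i` if `i ∈ S`). -/
def stepUp {m : ℕ} (M : ℝ) (S : Finset (Fin m)) (e : Fin m → ℝ) (i : Fin m) : ℝ :=
  sInf ((fun j => e j * M / (maxRank S e j : ℝ)) '' {j | j ∈ S ∧ e i ≤ e j})

/-- The function `f_i(x)`, computed with `M` in place of `m` and with the function `c` in the
place of `c₁`. -/
def fFun {m : ℕ} (M : ℝ) (c : ℝ → ℝ) (c₂ : ℝ) (S : Finset (Fin m)) (p₁ p₂ : Fin m → ℝ)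
    (i : Fin m) (x : ℝ) : ℝ :=
  stepUp M S (eValue M (c x) c₂ S p₁ p₂) i

/-- The set selected for follow-up at the outcome `ω`. -/
def selected {Ω : Type*} {m : ℕ} (S : (Fin m → ℝ) → Finset (Fin m)) (P₁ : Fin m → Ω → ℝ) (ω : Ω) :
    Finset (Fin m) :=
  S fun k => P₁ k ω

/-- The function `f_i(x)` at the outcome `ω`. -/
def fObs {Ω : Type*} {m : ℕ} (S : (Fin m → ℝ) → Finset (Fin m)) (P₁ P₂ : Fin m → Ω → ℝ)
    (M : ℝ) (c : ℝ → ℝ) (c₂ : ℝ) (ω : Ω) (i : Fin m) (x : ℝ) : ℝ :=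
  fFun M c c₂ (selected S P₁ ω) (fun k => P₁ k ω) (fun k => P₂ k ω) i x

open Classical in
/-- The solution in `(0,1)` of `f r = r` if there is one, and `1` otherwise. -/
def rValue (f : ℝ → ℝ) : ℝ :=
  if h : ∃ x, x ∈ Set.Ioo (0 : ℝ) 1 ∧ f x = x then h.choose else 1

open Classical in
/-- The minimum of the `x ∈ (0,1)` with `f x ≤ x` if there are such, and `1` otherwise. -/
def rValueMin (f : ℝ → ℝ) : ℝ :=
  if ∃ x, x ∈ Set.Ioo (0 : ℝ) 1 ∧ f x ≤ x then sInf {x | x ∈ Set.Ioo (0 : ℝ) 1 ∧ f x ≤ x} else 1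

/-- The set of features declared replicated: the selected ones whose `r`-value is at most `q`. -/
def declared {m : ℕ} (S : Finset (Fin m)) (r : Fin m → ℝ) (q : ℝ) : Finset (Fin m) :=
  S.filter fun i => r i ≤ q

/-- The proportion `(R₀₀ + R₀₁ + R₁₀) / max(R, 1)` of false replicability claims, when `N₁`, `N₂` are
the sets of features that are null in the primary and in the follow-up study and `D` is the set of
features declared replicated. -/
def fdp {m : ℕ} (N₁ N₂ D : Finset (Fin m)) : ℝ :=
  (((D ∩ (N₁ ∩ N₂)).card : ℝ) + ((D ∩ (N₁ \ N₂)).card : ℝ) + ((D ∩ (N₂ \ N₁)).card : ℝ)) /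
    max (D.card : ℝ) 1

/-- The expectation of the proportion of false replicability claims exists and is at most `q`. -/
def FDRControlled {Ω : Type*} [MeasurableSpace Ω] (μ : Measure Ω) {m : ℕ} (N₁ N₂ : Finset (Fin m))
    (D : Ω → Finset (Fin m)) (q : ℝ) : Prop :=
  Integrable (fun ω => fdp N₁ N₂ (D ω)) μ ∧ ∫ ω, fdp N₁ N₂ (D ω) ∂μ ≤ q

end Replicability

end

/-!
Fix `q < 1` (for `q ≥ 1` the bound is trivial, as the proportion is at most `1`). Then
the declared features are those rejected by a step-up procedure at level `q`: the largest set `D` of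
selected features such that `P₁ j ≤ |D| α` and `P₂ j ≤ |D| c₂ q / R₁` for all `j ∈ D`, where
`α = q c(q) / M`, with `c₁` or `c̃₁` for `c` and `m` or `m*` for `M`. Indeed `f_i(x) ≤ x` holds exactly
if such a set, at the level `x`, contains `i` (`fFun_le_iff`); and as `x c(x)` increases with `x`, is
right-continuous and tends to `0` at `0`, the set of these `x`, if nonempty, is an interval closed on the
left (`isLeast_fFun_le`). If `x c(x)` is strictly increasing and continuous, its left end point is the
only solution of `f_i(x) = x`. For `c̃₁`, monotonicity and right continuity come from the fact that
`x c̃₁(x)` is the largest `b` with `b (1 + ∑_{i ≤ ⌈tm/b - 1⌉} 1/i) ≤ x c₁(x)`, where the left hand side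
has only downward jumps.

The false discovery rate is the sum over the null features `i` of the expectations of
`w_i = 1{i ∈ D} / |D|`, which are estimated given one of the two studies (`lintegral_fdp_le`).

* Given the follow-up study, a feature that is null in the primary study contributes at most
  `γ = q c₁(q) / m`. For independent primary `p`-values, stability of the selection lets one put
  `P₁ i = 0` without changing `D` (`lintegral_weight_le_of_pi`); under arbitrary dependence, one pays a
  harmonic sum (`lintegral_le_of_threshold`), for which `m*` and `c̃₁` compensate. If `i` is null
  in both studies, the contribution is at most `γ c₂ q`, since `i ∈ D` forces `P₂ i ≤ c₂ q`.
* Given the primary study, each of the `R₁` selected features that is null in the follow-up study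
  contributes at most `c₂ q / R₁`, by the lemma of Benjamini and Yekutieli
  (`ConditionallyIncreasing.lintegral_le`). It needs only that `Pr(P₂ ∈ D | P₂ i ≤ a)` is nondecreasing
  in `a` for increasing sets `D`, which follows both from PRDS and from independence.

In total this is at most `m (1 - f₀₀ (1 - c₂ q)) γ + c₂ q`, which is at most `q` by the choice of `c₁`
and `l₀₀ ≤ f₀₀` (`fdr_bound_le`).
-/

namespace Replicability

/-! ### The step-up procedure as a self-consistent set -/

/-- A set `A` of features is self-consistent, for the slopes `α` and `β`, if the `p`-values of all its
members lie below the thresholds `|A| α` and `|A| β` that its own size determines. -/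
def SelfConsistent {m : ℕ} (α β : ℝ) (p₁ p₂ : Fin m → ℝ) (A : Finset (Fin m)) : Prop :=
  ∀ j ∈ A, p₁ j ≤ A.card * α ∧ p₂ j ≤ A.card * β

open Classical in
/-- The union of all self-consistent subsets of `s`. For `α, β ≥ 0` it is itself self-consistent, so
it is the largest self-consistent subset of `s`; this is the rejection set of the step-up procedure
(see `fFun_le_iff`). -/
noncomputable def rejection {m : ℕ} (s : Finset (Fin m)) (α β : ℝ) (p₁ p₂ : Fin m → ℝ) :
    Finset (Fin m) :=
  s.filter fun i => ∃ A ⊆ s, i ∈ A ∧ SelfConsistent α β p₁ p₂ A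

section Rejection

variable {m : ℕ} {s A : Finset (Fin m)} {α β : ℝ} {p₁ p₂ p₂' : Fin m → ℝ} {i : Fin m}

lemma mem_rejection :
    i ∈ rejection s α β p₁ p₂ ↔ ∃ A ⊆ s, i ∈ A ∧ SelfConsistent α β p₁ p₂ A := by
  simp only [rejection, Finset.mem_filter, and_iff_right_iff_imp]
  rintro ⟨A, hA, hi, -⟩
  exact hA hi

lemma rejection_subset : rejection s α β p₁ p₂ ⊆ s := by
  simp [rejection]

lemma SelfConsistent.subset_rejection (h : SelfConsistent α β p₁ p₂ A) (hA : A ⊆ s) :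
    A ⊆ rejection s α β p₁ p₂ :=
  fun _ hi => mem_rejection.2 ⟨A, hA, hi, h⟩

lemma selfConsistent_rejection (hα : 0 ≤ α) (hβ : 0 ≤ β) :
    SelfConsistent α β p₁ p₂ (rejection s α β p₁ p₂) := by
  intro j hj
  obtain ⟨A, hA, hjA, h⟩ := mem_rejection.1 hj
  have hc : (A.card : ℝ) ≤ (rejection s α β p₁ p₂).card := by
    exact_mod_cast Finset.card_le_card (h.subset_rejection hA)
  exact ⟨(h j hjA).1.trans (by gcongr), (h j hjA).2.trans (by gcongr)⟩

/-- Smaller follow-up `p`-values lead to more rejections. -/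
lemma rejection_anti_right (h : p₂ ≤ p₂') : rejection s α β p₁ p₂' ⊆ rejection s α β p₁ p₂ := by
  intro i hi
  obtain ⟨A, hA, hiA, hc⟩ := mem_rejection.1 hi
  exact mem_rejection.2 ⟨A, hA, hiA, fun j hj => ⟨(hc j hj).1, (h j).trans (hc j hj).2⟩⟩

/-- As long as `i` is rejected, its nonnegative primary `p`-value `x` does not influence the rejection
set, which is the one for `x = 0`. -/
lemma rejection_update_eq (hα : 0 ≤ α) (hβ : 0 ≤ β) {x : ℝ} (hx : 0 ≤ x)
    (hi : i ∈ rejection s α β (Function.update p₁ i x) p₂) :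
    rejection s α β (Function.update p₁ i x) p₂ = rejection s α β (Function.update p₁ i 0) p₂ := by
  have h1 := selfConsistent_rejection (s := s) (p₁ := Function.update p₁ i x) (p₂ := p₂) hα hβ
  have h0 := selfConsistent_rejection (s := s) (p₁ := Function.update p₁ i 0) (p₂ := p₂) hα hβ
  have hsub : rejection s α β (Function.update p₁ i x) p₂ ⊆
      rejection s α β (Function.update p₁ i 0) p₂ := by
    refine SelfConsistent.subset_rejection (fun j hj => ⟨?_, (h1 j hj).2⟩) rejection_subset
    refine le_trans ?_ (h1 j hj).1
    by_cases hji : j = i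
    · subst hji; simpa using hx
    · simp [hji]
  refine hsub.antisymm (SelfConsistent.subset_rejection (fun j hj => ⟨?_, (h0 j hj).2⟩)
    rejection_subset)
  by_cases hji : j = i
  · subst hji
    have hc : ((rejection s α β (Function.update p₁ j x) p₂).card : ℝ) ≤
        (rejection s α β (Function.update p₁ j 0) p₂).card := by
      exact_mod_cast Finset.card_le_card hsub
    exact (h1 j hi).1.trans (by gcongr)
  · simpa [hji] using (h0 j hj).1

end Rejection

section StepUp

variable {m : ℕ} {s : Finset (Fin m)} {i : Fin m}

/-- Replacing each member `e j * M / rank (e j)` of the minimum by the set `{k | e k ≤ e j}`, of size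
`rank (e j)`, turns bounds on `stepUp` into statements about sets. -/
lemma exists_stepUp {M : ℝ} (hM : 0 ≤ M) (e : Fin m → ℝ) (hi : i ∈ s) :
    ∃ A ⊆ s, i ∈ A ∧ ∀ j ∈ A, e j * M ≤ A.card * stepUp M s e i := by
  have hne : ((fun j => e j * M / (maxRank s e j : ℝ)) '' {j | j ∈ s ∧ e i ≤ e j}).Nonempty :=
    ⟨_, i, ⟨hi, le_rfl⟩, rfl⟩
  obtain ⟨j, ⟨hj, hij⟩, hje⟩ := hne.csInf_mem ((Set.toFinite _).image _)
  refine ⟨s.filter fun k => e k ≤ e j, Finset.filter_subset _ _, by simp [hi, hij], ?_⟩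
  have hrank : (0 : ℝ) < (s.filter fun k => e k ≤ e j).card := by
    have : j ∈ s.filter fun k => e k ≤ e j := by simp [hj]
    exact_mod_cast Finset.card_pos.2 ⟨j, this⟩
  intro k hk
  have hje' : e j * M = (s.filter fun k => e k ≤ e j).card * stepUp M s e i := by
    rw [mul_comm _ (stepUp M s e i), ← div_eq_iff hrank.ne']
    exact hje
  exact (mul_le_mul_of_nonneg_right (Finset.mem_filter.1 hk).2 hM).trans hje'.le

lemma stepUp_le {M : ℝ} (hM : 0 ≤ M) {e : Fin m → ℝ} (he : ∀ j ∈ s, 0 ≤ e j) {A : Finset (Fin m)}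
    (hA : A ⊆ s) (hiA : i ∈ A) {y : ℝ} (h : ∀ j ∈ A, e j * M ≤ A.card * y) :
    stepUp M s e i ≤ y := by
  obtain ⟨j, hjA, hj⟩ := A.exists_max_image e ⟨i, hiA⟩
  have hle : stepUp M s e i ≤ e j * M / (maxRank s e j : ℝ) :=
    csInf_le ((Set.toFinite _).image _).bddBelow ⟨j, ⟨hA hjA, hj i hiA⟩, rfl⟩
  refine hle.trans ?_
  have hcard : (A.card : ℝ) ≤ maxRank s e j := by
    exact_mod_cast Finset.card_le_card fun k hk => Finset.mem_filter.2 ⟨hA hk, hj k hk⟩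
  have hApos : (0 : ℝ) < A.card := by exact_mod_cast Finset.card_pos.2 ⟨i, hiA⟩
  exact (div_le_div_of_nonneg_left (mul_nonneg (he j (hA hjA)) hM) hApos hcard).trans
    ((div_le_iff₀ hApos).2 (by rw [mul_comm y]; exact h j hjA))

lemma stepUp_le_iff {M : ℝ} (hM : 0 ≤ M) {e : Fin m → ℝ} (he : ∀ j ∈ s, 0 ≤ e j) (hi : i ∈ s)
    {y : ℝ} : stepUp M s e i ≤ y ↔ ∃ A ⊆ s, i ∈ A ∧ ∀ j ∈ A, e j * M ≤ A.card * y := by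
  constructor
  · intro h
    obtain ⟨A, hA, hiA, hc⟩ := exists_stepUp hM e hi
    exact ⟨A, hA, hiA, fun j hj => (hc j hj).trans (by gcongr)⟩
  · rintro ⟨A, hA, hiA, hc⟩
    exact stepUp_le hM he hA hiA hc

lemma stepUp_lt_iff {M : ℝ} (hM : 0 ≤ M) {e : Fin m → ℝ} (he : ∀ j ∈ s, 0 ≤ e j) (hi : i ∈ s)
    {y : ℝ} : stepUp M s e i < y ↔ ∃ A ⊆ s, i ∈ A ∧ ∀ j ∈ A, e j * M < A.card * y := by
  constructor
  · intro h
    obtain ⟨A, hA, hiA, hc⟩ := exists_stepUp hM e hi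
    have hApos : (0 : ℝ) < A.card := by exact_mod_cast Finset.card_pos.2 ⟨i, hiA⟩
    exact ⟨A, hA, hiA, fun j hj => (hc j hj).trans_lt (by gcongr)⟩
  · rintro ⟨A, hA, hiA, hc⟩
    have hApos : (0 : ℝ) < A.card := by exact_mod_cast Finset.card_pos.2 ⟨i, hiA⟩
    obtain ⟨j, hjA, hj⟩ := A.exists_max_image e ⟨i, hiA⟩
    refine (stepUp_le hM he hA hiA (y := e j * M / A.card) fun k hk => ?_).trans_lt
      ((div_lt_iff₀ hApos).2 (by rw [mul_comm y]; exact hc j hjA))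
    rw [mul_div_cancel₀ _ hApos.ne']
    exact mul_le_mul_of_nonneg_right (hj k hk) hM

variable {M c₂ x : ℝ} {c : ℝ → ℝ} {p₁ p₂ : Fin m → ℝ}

lemma eValue_nonneg {C : ℝ} (hC : 0 ≤ C) (hp₁ : ∀ j, 0 ≤ p₁ j)
    (j : Fin m) : 0 ≤ eValue M C c₂ s p₁ p₂ j :=
  le_max_of_le_left (mul_nonneg (by positivity) (hp₁ j))

/-- With `f = fFun M c c₂ s p₁ p₂ i`, the bound `f x ≤ x` says that `i` is rejected by the step-up procedure with the slopes `x c(x) / M` and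
`c₂ x / |s|`; the factor `M` of the second component of the `e`-values cancels. -/
lemma fFun_le_iff (hM : 0 < M) (hc : 0 < c x) (hc₂ : 0 < c₂) (hp₁ : ∀ j, 0 ≤ p₁ j) (hi : i ∈ s) :
    fFun M c c₂ s p₁ p₂ i x ≤ x ↔
      i ∈ rejection s (x * c x / M) (c₂ * x / s.card) p₁ p₂ := by
  have hs : (0 : ℝ) < s.card := by exact_mod_cast Finset.card_pos.2 ⟨i, hi⟩
  rw [fFun, stepUp_le_iff hM.le (fun j _ => eValue_nonneg hc.le hp₁ j) hi,
    mem_rejection]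
  refine exists_congr fun A => and_congr_right fun _ => and_congr_right fun _ =>
    forall₂_congr fun j _ => ?_
  rw [eValue, max_mul_of_nonneg _ _ hM.le, max_le_iff]
  refine and_congr ?_ ?_
  · rw [show 1 / c x * p₁ j * M = p₁ j * (M / c x) by ring, ← le_div_iff₀ (by positivity)]
    exact iff_of_eq (by congr 1; field_simp)
  · rw [show (s.card : ℝ) / (M * c₂) * p₂ j * M = p₂ j * (s.card / c₂) by field_simp,
      ← le_div_iff₀ (by positivity)]
    exact iff_of_eq (by congr 1; field_simp)

lemma fFun_lt_iff (hM : 0 < M) (hc : 0 < c x) (hc₂ : 0 < c₂) (hp₁ : ∀ j, 0 ≤ p₁ j) (hi : i ∈ s) :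
    fFun M c c₂ s p₁ p₂ i x < x ↔ ∃ A ⊆ s, i ∈ A ∧ ∀ j ∈ A,
      p₁ j < A.card * (x * c x / M) ∧ p₂ j < A.card * (c₂ * x / s.card) := by
  have hs : (0 : ℝ) < s.card := by exact_mod_cast Finset.card_pos.2 ⟨i, hi⟩
  rw [fFun, stepUp_lt_iff hM.le (fun j _ => eValue_nonneg hc.le hp₁ j) hi]
  refine exists_congr fun A => and_congr_right fun _ => and_congr_right fun _ =>
    forall₂_congr fun j _ => ?_
  rw [eValue, max_mul_of_nonneg _ _ hM.le, max_lt_iff]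
  refine and_congr ?_ ?_
  · rw [show 1 / c x * p₁ j * M = p₁ j * (M / c x) by ring, ← lt_div_iff₀ (by positivity)]
    exact iff_of_eq (by congr 1; field_simp)
  · rw [show (s.card : ℝ) / (M * c₂) * p₂ j * M = p₂ j * (s.card / c₂) by field_simp,
      ← lt_div_iff₀ (by positivity)]
    exact iff_of_eq (by congr 1; field_simp)

end StepUp

/-! ### Existence and uniqueness of the `r`-values -/

section RValue

open Filter Topology

variable {m : ℕ} {s : Finset (Fin m)} {i : Fin m} {M c₂ : ℝ} {c : ℝ → ℝ} {p₁ p₂ : Fin m → ℝ}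

lemma fFun_le_of_le (hM : 0 < M) (hc₂ : 0 < c₂) (hp₁ : ∀ j, 0 ≤ p₁ j) (hi : i ∈ s)
    (hc : ∀ x ∈ Set.Ioo (0 : ℝ) 1, 0 < c x) (hmono : MonotoneOn (fun x => x * c x) (Set.Ioo 0 1))
    {x y : ℝ} (hx : x ∈ Set.Ioo (0 : ℝ) 1) (hy : y ∈ Set.Ioo (0 : ℝ) 1) (hxy : x ≤ y)
    (h : fFun M c c₂ s p₁ p₂ i x ≤ x) : fFun M c c₂ s p₁ p₂ i y ≤ y := by
  rw [fFun_le_iff hM (hc x hx) hc₂ hp₁ hi, mem_rejection] at h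
  rw [fFun_le_iff hM (hc y hy) hc₂ hp₁ hi, mem_rejection]
  obtain ⟨A, hA, hiA, h⟩ := h
  have hxy' : x * c x ≤ y * c y := hmono hx hy hxy
  exact ⟨A, hA, hiA, fun j hj => ⟨(h j hj).1.trans (by gcongr), (h j hj).2.trans (by gcongr)⟩⟩

/-- The strict conclusion is what makes the solution of `f x = x` unique. -/
lemma fFun_lt_of_lt (hM : 0 < M) (hc₂ : 0 < c₂) (hp₁ : ∀ j, 0 ≤ p₁ j) (hi : i ∈ s)
    (hc : ∀ x ∈ Set.Ioo (0 : ℝ) 1, 0 < c x) (hmono : StrictMonoOn (fun x => x * c x) (Set.Ioo 0 1))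
    {x y : ℝ} (hx : x ∈ Set.Ioo (0 : ℝ) 1) (hy : y ∈ Set.Ioo (0 : ℝ) 1) (hxy : x < y)
    (h : fFun M c c₂ s p₁ p₂ i x ≤ x) : fFun M c c₂ s p₁ p₂ i y < y := by
  rw [fFun_le_iff hM (hc x hx) hc₂ hp₁ hi, mem_rejection] at h
  rw [fFun_lt_iff hM (hc y hy) hc₂ hp₁ hi]
  obtain ⟨A, hA, hiA, h⟩ := h
  have hs : (0 : ℝ) < s.card := by exact_mod_cast Finset.card_pos.2 ⟨i, hi⟩
  have hApos : (0 : ℝ) < A.card := by exact_mod_cast Finset.card_pos.2 ⟨i, hiA⟩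
  have hxy' : x * c x < y * c y := hmono hx hy hxy
  exact ⟨A, hA, hiA, fun j hj =>
    ⟨(h j hj).1.trans_lt (by gcongr), (h j hj).2.trans_lt (by gcongr)⟩⟩

/-- If `f x ≤ x` for some `x ∈ (0,1)`, then there is a least such `x`. Boundedness of `c` keeps the
infimum away from `0`; the infimum is attained because `x c(x)` is right-continuous (in the form
`hright`, to which right continuity amounts for a monotone function) and only finitely many sets are
candidates for a self-consistent one. -/
lemma isLeast_fFun_le (hM : 0 < M) (hc₂ : 0 < c₂) (hp₁ : ∀ j, 0 < p₁ j) (hi : i ∈ s)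
    (hc : ∀ x ∈ Set.Ioo (0 : ℝ) 1, 0 < c x) (hmono : MonotoneOn (fun x => x * c x) (Set.Ioo 0 1))
    {C : ℝ} (hC : ∀ x ∈ Set.Ioo (0 : ℝ) 1, c x ≤ C)
    (hright : ∀ x ∈ Set.Ioo (0 : ℝ) 1, ∀ v, (∀ y ∈ Set.Ioo x 1, v ≤ y * c y) → v ≤ x * c x)
    (hex : ∃ x ∈ Set.Ioo (0 : ℝ) 1, fFun M c c₂ s p₁ p₂ i x ≤ x) :
    IsLeast {x | x ∈ Set.Ioo (0 : ℝ) 1 ∧ fFun M c c₂ s p₁ p₂ i x ≤ x}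
      (sInf {x | x ∈ Set.Ioo (0 : ℝ) 1 ∧ fFun M c c₂ s p₁ p₂ i x ≤ x}) := by
  set T := {x | x ∈ Set.Ioo (0 : ℝ) 1 ∧ fFun M c c₂ s p₁ p₂ i x ≤ x} with hT
  have hp₁' : ∀ j, 0 ≤ p₁ j := fun j => (hp₁ j).le
  obtain ⟨x₀, hx₀, hfx₀⟩ := hex
  have hx₀T : x₀ ∈ T := ⟨hx₀, hfx₀⟩
  have hs : (0 : ℝ) < s.card := by exact_mod_cast Finset.card_pos.2 ⟨i, hi⟩
  have hCpos : 0 < C := (hc x₀ hx₀).trans_le (hC x₀ hx₀)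
  have hbdd : ∀ x ∈ T, p₁ i * M / (s.card * C) ≤ x := by
    rintro x ⟨hx, hfx⟩
    rw [fFun_le_iff hM (hc x hx) hc₂ hp₁' hi, mem_rejection] at hfx
    obtain ⟨A, hA, hiA, h⟩ := hfx
    have h1 := (h i hiA).1
    have hAs : (A.card : ℝ) ≤ s.card := by exact_mod_cast Finset.card_le_card hA
    rw [div_le_iff₀ (by positivity)]
    calc p₁ i * M ≤ A.card * (x * c x / M) * M := by gcongr
      _ = A.card * (x * c x) := by field_simp
      _ ≤ s.card * (x * C) := by
          have := hx.1
          have := hc x hx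
          have := hC x hx
          gcongr
      _ = x * (s.card * C) := by ring
  have hbelow : BddBelow T := ⟨_, hbdd⟩
  refine ⟨?_, fun x hx => csInf_le hbelow hx⟩
  set r := sInf T with hr
  have hr0 : 0 < r := lt_of_lt_of_le (by have := hp₁ i; positivity) (le_csInf ⟨_, hx₀T⟩ hbdd)
  have hr1 : r < 1 := (csInf_le hbelow hx₀T).trans_lt hx₀.2
  have hrI : r ∈ Set.Ioo (0 : ℝ) 1 := ⟨hr0, hr1⟩
  have hgt : ∀ y ∈ Set.Ioo r 1, y ∈ T := by
    rintro y ⟨hy, hy1⟩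
    obtain ⟨x, hxT, hxy⟩ := exists_lt_of_csInf_lt ⟨_, hx₀T⟩ hy
    have hyI : y ∈ Set.Ioo (0 : ℝ) 1 := ⟨hr0.trans hy, hy1⟩
    exact ⟨hyI, fFun_le_of_le hM hc₂ hp₁' hi hc hmono hxT.1 hyI hxy.le hxT.2⟩
  refine ⟨hrI, (fFun_le_iff hM (hc r hrI) hc₂ hp₁' hi).2 (mem_rejection.2 ?_)⟩
  have hev : ∀ᶠ y in 𝓝[>] r, ∃ A : Finset (Fin m), (A ⊆ s ∧ i ∈ A ∧
      SelfConsistent (y * c y / M) (c₂ * y / s.card) p₁ p₂ A) := by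
    filter_upwards [Ioo_mem_nhdsGT hr1] with y hy
    have hyT := hgt y hy
    exact mem_rejection.1 ((fFun_le_iff hM (hc y hyT.1) hc₂ hp₁' hi).1 hyT.2)
  -- one of the finitely many sets works arbitrarily close to `r`
  obtain ⟨A, hfr⟩ : ∃ A : Finset (Fin m), ∃ᶠ y in 𝓝[>] r, A ⊆ s ∧ i ∈ A ∧
      SelfConsistent (y * c y / M) (c₂ * y / s.card) p₁ p₂ A := by
    by_contra hno
    simp only [not_exists, not_frequently] at hno
    obtain ⟨y, ⟨A, hA⟩, hy⟩ := (hev.and (eventually_all.2 hno)).exists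
    exact hy A hA
  obtain ⟨hAs, hiA, -⟩ := hfr.exists.choose_spec
  have hApos : (0 : ℝ) < A.card := by exact_mod_cast Finset.card_pos.2 ⟨i, hiA⟩
  have hall : ∀ y ∈ Set.Ioo r 1, SelfConsistent (y * c y / M) (c₂ * y / s.card) p₁ p₂ A := by
    intro y hy
    obtain ⟨z, ⟨-, -, hz⟩, hzI⟩ := (hfr.and_eventually (Ioo_mem_nhdsGT hy.1)).exists
    have hle : z * c z ≤ y * c y :=
      hmono ⟨hr0.trans hzI.1, hzI.2.trans hy.2⟩ ⟨hr0.trans hy.1, hy.2⟩ hzI.2.le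
    have := hzI.2.le
    exact fun j hj => ⟨(hz j hj).1.trans (by gcongr), (hz j hj).2.trans (by gcongr)⟩
  refine ⟨A, hAs, hiA, fun j hj => ⟨?_, ?_⟩⟩
  · have := hright r hrI (p₁ j * M / A.card) fun y hy => by
      rw [div_le_iff₀ hApos]
      have := (hall y hy j hj).1
      calc p₁ j * M ≤ A.card * (y * c y / M) * M := by gcongr
        _ = y * c y * A.card := by field_simp
    rw [div_le_iff₀ hApos] at this
    rw [← mul_div_assoc, le_div_iff₀ hM]
    linarith
  · have : p₂ j * s.card / (A.card * c₂) ≤ r := by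
      refine le_of_forall_gt_imp_ge_of_dense fun y hy => ?_
      rcases lt_or_ge y 1 with hy1 | hy1
      · rw [div_le_iff₀ (by positivity)]
        have := (hall y ⟨hy, hy1⟩ j hj).2
        calc p₂ j * s.card ≤ A.card * (c₂ * y / s.card) * s.card := by gcongr
          _ = y * (A.card * c₂) := by field_simp
      · obtain ⟨z, hz⟩ := exists_between hr1
        refine le_trans ?_ (hz.2.le.trans hy1)
        rw [div_le_iff₀ (by positivity)]
        have := (hall z hz j hj).2
        calc p₂ j * s.card ≤ A.card * (c₂ * z / s.card) * s.card := by gcongr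
          _ = z * (A.card * c₂) := by field_simp
    rw [div_le_iff₀ (by positivity)] at this
    rw [← mul_div_assoc, le_div_iff₀ hs]
    linarith

/-- The least `x` with `f x ≤ x` is a fixed point of `f` if `x c(x)` is continuous: a strict
inequality would persist slightly to the left. -/
lemma fFun_eq_of_isLeast (hM : 0 < M) (hc₂ : 0 < c₂) (hp₁ : ∀ j, 0 ≤ p₁ j) (hi : i ∈ s)
    (hc : ∀ x ∈ Set.Ioo (0 : ℝ) 1, 0 < c x)
    (hcont : ∀ x ∈ Set.Ioo (0 : ℝ) 1, ContinuousAt (fun x => x * c x) x) {r : ℝ}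
    (hr : IsLeast {x | x ∈ Set.Ioo (0 : ℝ) 1 ∧ fFun M c c₂ s p₁ p₂ i x ≤ x} r) :
    fFun M c c₂ s p₁ p₂ i r = r := by
  obtain ⟨⟨hrI, hfr⟩, hmin⟩ := hr
  refine hfr.antisymm (not_lt.1 fun hlt => ?_)
  obtain ⟨A, hA, hiA, h⟩ := (fFun_lt_iff hM (hc r hrI) hc₂ hp₁ hi).1 hlt
  have hev : ∀ᶠ y in 𝓝 r, ∀ j ∈ A,
      p₁ j < A.card * (y * c y / M) ∧ p₂ j < A.card * (c₂ * y / s.card) := by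
    refine (Filter.eventually_all_finset A).2 fun j hj => ?_
    have h1 : ContinuousAt (fun y => A.card * (y * c y / M)) r :=
      continuousAt_const.mul ((hcont r hrI).div_const M)
    have h2 : ContinuousAt (fun y => A.card * (c₂ * y / s.card)) r := by fun_prop
    exact (h1.eventually_const_lt (h j hj).1).and (h2.eventually_const_lt (h j hj).2)
  have hev' : ∀ᶠ y in 𝓝[<] r, y < r := self_mem_nhdsWithin
  obtain ⟨y, ⟨hy, hyI⟩, hyr⟩ := ((((hev.and (Ioo_mem_nhds hrI.1 hrI.2))).filter_mono
    nhdsWithin_le_nhds).and hev').exists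
  exact absurd (hmin ⟨hyI, ((fFun_lt_iff hM (hc y hyI) hc₂ hp₁ hi).2 ⟨A, hA, hiA, hy⟩).le⟩)
    (not_le.2 hyr)

/-- Below `1`, comparing the `r`-value with `q` amounts to comparing `f q` with `q`. -/
lemma rValue_le_iff {f : ℝ → ℝ} {q : ℝ} (hq : q ∈ Set.Ioo (0 : ℝ) 1)
    (hmono : ∀ x ∈ Set.Ioo (0 : ℝ) 1, x ≤ q → f x ≤ x → f q ≤ q)
    (hlt : ∀ x ∈ Set.Ioo (0 : ℝ) 1, q < x → f q ≤ q → f x < x)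
    (hex : f q ≤ q → ∃ x ∈ Set.Ioo (0 : ℝ) 1, f x = x) :
    rValue f ≤ q ↔ f q ≤ q := by
  unfold rValue
  constructor
  · intro h
    split_ifs at h with hx
    · exact hmono _ hx.choose_spec.1 h hx.choose_spec.2.le
    · exact absurd h (not_le.2 hq.2)
  · intro h
    have hx := hex h
    rw [dif_pos hx]
    refine not_lt.1 fun hlt' => ?_
    exact (hlt _ hx.choose_spec.1 hlt' h).ne hx.choose_spec.2

lemma rValueMin_le_iff {f : ℝ → ℝ} {q : ℝ} (hq : q ∈ Set.Ioo (0 : ℝ) 1)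
    (hmono : ∀ x ∈ Set.Ioo (0 : ℝ) 1, x ≤ q → f x ≤ x → f q ≤ q)
    (hleast : (∃ x ∈ Set.Ioo (0 : ℝ) 1, f x ≤ x) →
      IsLeast {x | x ∈ Set.Ioo (0 : ℝ) 1 ∧ f x ≤ x} (sInf {x | x ∈ Set.Ioo (0 : ℝ) 1 ∧ f x ≤ x})) :
    rValueMin f ≤ q ↔ f q ≤ q := by
  unfold rValueMin
  constructor
  · intro h
    split_ifs at h with hx
    · exact hmono _ (hleast hx).1.1 h (hleast hx).1.2
    · exact absurd h (not_le.2 hq.2)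
  · intro h
    rw [if_pos ⟨q, hq, h⟩]
    exact (hleast ⟨q, hq, h⟩).2 ⟨hq, h⟩

end RValue

/-! ### The constants `c₁(x)` and `c̃₁(x)` -/

section Constants

variable {l₀₀ c₂ : ℝ}

lemma c1_denom_pos (hl : l₀₀ ∈ Set.Ico (0 : ℝ) 1) (hc₂ : c₂ ∈ Set.Ioo (0 : ℝ) 1) {x : ℝ}
    (hx : 0 < x) : 1 - l₀₀ ≤ 1 - l₀₀ * (1 - c₂ * x) := by
  nlinarith [mul_nonneg hl.1 (mul_pos hc₂.1 hx).le]

lemma c1_pos (hl : l₀₀ ∈ Set.Ico (0 : ℝ) 1) (hc₂ : c₂ ∈ Set.Ioo (0 : ℝ) 1) {x : ℝ}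
    (hx : 0 < x) : 0 < c1 l₀₀ c₂ x := by
  have := c1_denom_pos hl hc₂ hx
  exact div_pos (by linarith [hc₂.2]) (by linarith [hl.2])

lemma c1_le (hl : l₀₀ ∈ Set.Ico (0 : ℝ) 1) (hc₂ : c₂ ∈ Set.Ioo (0 : ℝ) 1) {x : ℝ}
    (hx : 0 < x) : c1 l₀₀ c₂ x ≤ (1 - c₂) / (1 - l₀₀) :=
  div_le_div_of_nonneg_left (by linarith [hc₂.2]) (by linarith [hl.2]) (c1_denom_pos hl hc₂ hx)

lemma strictMonoOn_mul_c1 (hl : l₀₀ ∈ Set.Ico (0 : ℝ) 1) (hc₂ : c₂ ∈ Set.Ioo (0 : ℝ) 1) :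
    StrictMonoOn (fun x => x * c1 l₀₀ c₂ x) (Set.Ioi 0) := by
  intro x hx y hy hxy
  have hx' : 0 < 1 - l₀₀ * (1 - c₂ * x) := by linarith [c1_denom_pos hl hc₂ hx, hl.2]
  have hy' : 0 < 1 - l₀₀ * (1 - c₂ * y) := by linarith [c1_denom_pos hl hc₂ hy, hl.2]
  have h2 : 0 < 1 - c₂ := by linarith [hc₂.2]
  simp only [c1, ← mul_div_assoc]
  rw [div_lt_div_iff₀ hx' hy']
  have : 0 < (1 - c₂) * (1 - l₀₀) * (y - x) :=
    mul_pos (mul_pos h2 (by linarith [hl.2])) (by linarith)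
  nlinarith

lemma continuousAt_mul_c1 (hl : l₀₀ ∈ Set.Ico (0 : ℝ) 1) (hc₂ : c₂ ∈ Set.Ioo (0 : ℝ) 1) {x : ℝ}
    (hx : 0 < x) : ContinuousAt (fun x => x * c1 l₀₀ c₂ x) x := by
  have hx' : 1 - l₀₀ * (1 - c₂ * x) ≠ 0 := by linarith [c1_denom_pos hl hc₂ hx, hl.2]
  unfold c1
  fun_prop (disch := assumption)

end Constants

section ThresholdConstant

open Filter Topology

/-- The function `b ↦ b (1 + ∑_{i=1}^{⌈τ/b - 1⌉} 1/i)`. In terms of `b = a x` and `τ = t m`, the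
equation that defines `c̃₁(x)` reads `thresholdFun τ b = x c₁(x)`. -/
noncomputable def thresholdFun (τ b : ℝ) : ℝ :=
  b * (1 + ∑ i ∈ Finset.Icc 1 ⌈τ / b - 1⌉₊, 1 / (i : ℝ))

/-- The harmonic factor that goes with the cut-off `k`. -/
noncomputable def harmonicFactor (k : ℕ) : ℝ := 1 + ∑ i ∈ Finset.Icc 1 k, 1 / (i : ℝ)

lemma one_le_harmonicFactor (k : ℕ) : 1 ≤ harmonicFactor k :=
  le_add_of_nonneg_right (Finset.sum_nonneg fun i _ => by positivity)

lemma harmonicFactor_mono : Monotone harmonicFactor := by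
  intro k l h
  unfold harmonicFactor
  gcongr

variable {τ : ℝ}

lemma thresholdFun_eq (b : ℝ) : thresholdFun τ b = b * harmonicFactor ⌈τ / b - 1⌉₊ := rfl

lemma ceil_anti (hτ : 0 ≤ τ) {b b' : ℝ} (hb : 0 < b) (h : b ≤ b') :
    ⌈τ / b' - 1⌉₊ ≤ ⌈τ / b - 1⌉₊ :=
  Nat.ceil_mono (by gcongr)

/-- `thresholdFun τ` is at least its value at `b` immediately to the right of `b`: it has jumps, but
the harmonic factor is constant there. -/
lemma exists_forall_thresholdFun_le {b : ℝ} (hb : 0 < b) :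
    ∃ b₁ > b, ∀ b' ∈ Set.Ico b b₁, thresholdFun τ b ≤ thresholdFun τ b' := by
  set k := ⌈τ / b - 1⌉₊ with hk
  have key : ∀ b' ≥ b, k ≤ ⌈τ / b' - 1⌉₊ → thresholdFun τ b ≤ thresholdFun τ b' := by
    intro b' hb' hle
    rw [thresholdFun_eq, thresholdFun_eq]
    exact mul_le_mul hb' (harmonicFactor_mono hle) (by linarith [one_le_harmonicFactor k])
      (hb.le.trans hb')
  rcases Nat.eq_zero_or_pos k with h0 | hpos
  · exact ⟨b + 1, by linarith, fun b' hb' => key b' hb'.1 (by omega)⟩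
  · have hkr : (0 : ℝ) < k := by exact_mod_cast hpos
    have h1 : ((k - 1 : ℕ) : ℝ) < τ / b - 1 := Nat.lt_ceil.1 (by omega)
    rw [Nat.cast_pred hpos, sub_lt_sub_iff_right, lt_div_iff₀ hb] at h1
    refine ⟨τ / k, by rw [gt_iff_lt, lt_div_iff₀ hkr]; linarith, fun b' hb' => key b' hb'.1 ?_⟩
    have hb'0 : 0 < b' := hb.trans_le hb'.1
    have h2 : ((k - 1 : ℕ) : ℝ) < τ / b' - 1 := by
      rw [Nat.cast_pred hpos, sub_lt_sub_iff_right, lt_div_iff₀ hb'0]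
      have := (lt_div_iff₀ hkr).1 hb'.2
      linarith
    have := Nat.lt_ceil.2 h2
    omega

lemma exists_pos_thresholdFun_le (hτ : 0 ≤ τ) {y : ℝ} (hy : 0 < y) :
    ∃ b > 0, thresholdFun τ b ≤ y := by
  rcases hτ.eq_or_lt with rfl | hτ
  · refine ⟨y, hy, ?_⟩
    have : ⌈(0 : ℝ) / y - 1⌉₊ = 0 := by simp
    rw [thresholdFun_eq, this]
    simp [harmonicFactor]
  · -- at `b = τ / n` the value is at most `2 τ` times the mean of `1, 1/2, …, 1/n`
    have h := (tendsto_one_div_add_atTop_nhds_zero_nat (𝕜 := ℝ)).cesaro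
    have hev := h.eventually_lt_const (show 0 < y / (2 * τ) by positivity)
    obtain ⟨n, hn, hn1⟩ := (hev.and (eventually_ge_atTop 1)).exists
    have hnr : (0 : ℝ) < n := by exact_mod_cast hn1
    refine ⟨τ / n, by positivity, ?_⟩
    have hceil : ⌈τ / (τ / n) - 1⌉₊ = n - 1 := by
      rw [div_div_cancel₀ hτ.ne', ← Nat.cast_pred hn1, Nat.ceil_natCast]
    have hsum : ∑ i ∈ Finset.Icc 1 n, 1 / (i : ℝ) = ∑ i ∈ Finset.range n, 1 / ((i : ℝ) + 1) := by
      rw [Finset.range_eq_Ico]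
      have := Finset.sum_Ico_add' (fun i : ℕ => 1 / (i : ℝ)) 0 n 1
      push_cast at this
      rw [this]
      rfl
    have h1 : (1 : ℝ) ≤ ∑ i ∈ Finset.Icc 1 n, 1 / (i : ℝ) := by
      have := Finset.single_le_sum (f := fun i : ℕ => 1 / (i : ℝ)) (s := Finset.Icc 1 n)
        (fun i _ => by positivity) (Finset.mem_Icc.2 ⟨le_rfl, hn1⟩)
      simpa using this
    have h2 : harmonicFactor (n - 1) ≤ 1 + ∑ i ∈ Finset.Icc 1 n, 1 / (i : ℝ) :=
      harmonicFactor_mono (Nat.sub_le n 1)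
    rw [thresholdFun_eq, hceil]
    rw [← hsum, lt_div_iff₀ (by positivity)] at hn
    calc τ / n * harmonicFactor (n - 1)
        ≤ τ / n * (2 * ∑ i ∈ Finset.Icc 1 n, 1 / (i : ℝ)) := by gcongr; linarith
      _ = (n : ℝ)⁻¹ * (∑ i ∈ Finset.Icc 1 n, 1 / (i : ℝ)) * (2 * τ) := by
          field_simp
      _ ≤ y := hn.le

/-- The largest `b` with `thresholdFun τ b ≤ y` exists, and equality holds there. -/
lemma exists_isGreatest_thresholdFun (hτ : 0 ≤ τ) {y : ℝ} (hy : 0 < y) :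
    ∃ b > 0, thresholdFun τ b = y ∧ ∀ b', thresholdFun τ b' ≤ y → b' ≤ b := by
  obtain ⟨b₀, hb₀, hb₀y⟩ := exists_pos_thresholdFun_le hτ hy
  set B := {b | 0 < b ∧ thresholdFun τ b ≤ y} with hB
  have hbdd : BddAbove B := by
    refine ⟨y, fun b hb => le_trans ?_ hb.2⟩
    rw [thresholdFun_eq]
    exact le_mul_of_one_le_right hb.1.le (one_le_harmonicFactor _)
  set b := sSup B with hbdef
  have hb : 0 < b := hb₀.trans_le (le_csSup hbdd ⟨hb₀, hb₀y⟩)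
  set k := ⌈τ / b - 1⌉₊ with hk
  have hkpos : 0 < harmonicFactor k := by linarith [one_le_harmonicFactor k]
  have hle : b ≤ y / harmonicFactor k := by
    refine csSup_le ⟨b₀, hb₀, hb₀y⟩ fun b' hb' => ?_
    rw [le_div_iff₀ hkpos]
    refine le_trans ?_ hb'.2
    rw [thresholdFun_eq]
    exact mul_le_mul_of_nonneg_left
      (harmonicFactor_mono (ceil_anti hτ hb'.1 (le_csSup hbdd hb'))) hb'.1.le
  have hmem : y / harmonicFactor k ∈ B := by
    refine ⟨by positivity, ?_⟩
    rw [thresholdFun_eq]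
    calc _ ≤ y / harmonicFactor k * harmonicFactor k :=
          mul_le_mul_of_nonneg_left (harmonicFactor_mono (ceil_anti hτ hb hle)) (by positivity)
      _ = y := by field_simp
  have heq : b = y / harmonicFactor k := hle.antisymm (le_csSup hbdd hmem)
  refine ⟨b, hb, ?_, fun b' hb' => ?_⟩
  · rw [thresholdFun_eq, ← hk, heq]
    field_simp
  · rcases le_or_gt b' 0 with h0 | h0
    · exact h0.trans hb.le
    · exact le_csSup hbdd ⟨h0, hb'⟩

variable {m : ℕ} {t l₀₀ c₂ : ℝ}

lemma mem_c1TildeSet_iff {x a : ℝ} (hx : 0 < x) :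
    a ∈ c1TildeSet m t l₀₀ c₂ x ↔ thresholdFun (t * m) (a * x) = x * c1 l₀₀ c₂ x := by
  rw [thresholdFun, c1TildeSet, Set.mem_ofPred_eq]
  constructor
  · intro h
    rw [← h]; ring
  · intro h
    refine mul_left_cancel₀ hx.ne' ?_
    rw [← h]; ring

/-- `x c̃₁(x)` is the largest solution `b` of `thresholdFun (t m) b ≤ x c₁(x)`. -/
lemma c1Tilde_spec (hl : l₀₀ ∈ Set.Ico (0 : ℝ) 1) (hc₂ : c₂ ∈ Set.Ioo (0 : ℝ) 1) (ht : 0 ≤ t)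
    {x : ℝ} (hx : 0 < x) :
    IsGreatest (c1TildeSet m t l₀₀ c₂ x) (c1Tilde m t l₀₀ c₂ x) ∧ 0 < c1Tilde m t l₀₀ c₂ x ∧
      ∀ b, thresholdFun (t * m) b ≤ x * c1 l₀₀ c₂ x → b ≤ x * c1Tilde m t l₀₀ c₂ x := by
  obtain ⟨b, hb, hby, hmax⟩ := exists_isGreatest_thresholdFun (τ := t * m) (by positivity)
    (mul_pos hx (c1_pos hl hc₂ hx))
  have hg : IsGreatest (c1TildeSet m t l₀₀ c₂ x) (b / x) := by
    refine ⟨?_, fun a ha => ?_⟩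
    · rw [mem_c1TildeSet_iff hx, div_mul_cancel₀ _ hx.ne']
      exact hby
    · rw [le_div_iff₀ hx]
      exact hmax _ ((mem_c1TildeSet_iff hx).1 ha).le
  have heq : c1Tilde m t l₀₀ c₂ x = b / x := hg.csSup_eq
  rw [heq, mul_div_cancel₀ _ hx.ne']
  exact ⟨hg, by positivity, hmax⟩

lemma thresholdFun_c1Tilde (hl : l₀₀ ∈ Set.Ico (0 : ℝ) 1) (hc₂ : c₂ ∈ Set.Ioo (0 : ℝ) 1)
    (ht : 0 ≤ t) {x : ℝ} (hx : 0 < x) :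
    thresholdFun (t * m) (x * c1Tilde m t l₀₀ c₂ x) = x * c1 l₀₀ c₂ x := by
  have := (mem_c1TildeSet_iff hx).1 (c1Tilde_spec (m := m) hl hc₂ ht hx).1.1
  rwa [mul_comm _ x] at this

lemma c1Tilde_le (hl : l₀₀ ∈ Set.Ico (0 : ℝ) 1) (hc₂ : c₂ ∈ Set.Ioo (0 : ℝ) 1) (ht : 0 ≤ t)
    {x : ℝ} (hx : 0 < x) : c1Tilde m t l₀₀ c₂ x ≤ (1 - c₂) / (1 - l₀₀) := by
  refine le_trans ?_ (c1_le hl hc₂ hx)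
  rw [← mul_le_mul_iff_right₀ hx, ← thresholdFun_c1Tilde (m := m) hl hc₂ ht hx, thresholdFun_eq]
  exact le_mul_of_one_le_right (mul_pos hx (c1Tilde_spec hl hc₂ ht hx).2.1).le
    (one_le_harmonicFactor _)

lemma monotoneOn_mul_c1Tilde (hl : l₀₀ ∈ Set.Ico (0 : ℝ) 1) (hc₂ : c₂ ∈ Set.Ioo (0 : ℝ) 1)
    (ht : 0 ≤ t) : MonotoneOn (fun x => x * c1Tilde m t l₀₀ c₂ x) (Set.Ioi 0) := by
  intro x hx y hy hxy
  refine (c1Tilde_spec hl hc₂ ht hy).2.2 _ ?_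
  rw [thresholdFun_c1Tilde hl hc₂ ht hx]
  exact (strictMonoOn_mul_c1 hl hc₂).monotoneOn hx hy hxy

/-- Right continuity of `x c̃₁(x)`. The limit `b` of `y c̃₁(y)` as `y` decreases to `x` satisfies
`thresholdFun (t m) b ≤ x c₁(x)`, as `thresholdFun (t m)` does not jump down immediately to the right
of `b`; and `x c̃₁(x)` is the largest such number. -/
lemma mul_c1Tilde_right_cont (hl : l₀₀ ∈ Set.Ico (0 : ℝ) 1) (hc₂ : c₂ ∈ Set.Ioo (0 : ℝ) 1)
    (ht : 0 ≤ t) {x x₁ : ℝ} (hx : 0 < x) (hx₁ : x < x₁) (v : ℝ)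
    (hv : ∀ y ∈ Set.Ioo x x₁, v ≤ y * c1Tilde m t l₀₀ c₂ y) : v ≤ x * c1Tilde m t l₀₀ c₂ x := by
  set φ := fun y => y * c1Tilde m t l₀₀ c₂ y with hφ
  have hmono : MonotoneOn φ (Set.Ioi 0) := monotoneOn_mul_c1Tilde hl hc₂ ht
  set b := sInf (φ '' Set.Ioo x x₁) with hb
  have hne : (φ '' Set.Ioo x x₁).Nonempty := (Set.nonempty_Ioo.2 hx₁).image _
  have hbelow : φ x ∈ lowerBounds (φ '' Set.Ioo x x₁) := by
    rintro _ ⟨y, hy, rfl⟩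
    exact hmono hx (hx.trans hy.1) hy.1.le
  have hφx : 0 < φ x := mul_pos hx (c1Tilde_spec hl hc₂ ht hx).2.1
  have hb0 : 0 < b := hφx.trans_le (le_csInf hne hbelow)
  have hvb : v ≤ b := le_csInf hne (by rintro _ ⟨y, hy, rfl⟩; exact hv y hy)
  refine hvb.trans ((c1Tilde_spec hl hc₂ ht hx).2.2 _ ?_)
  obtain ⟨b₁, hb₁, hloc⟩ := exists_forall_thresholdFun_le (τ := t * m) hb0
  obtain ⟨_, ⟨y₀, hy₀, rfl⟩, hy₀b⟩ := exists_lt_of_csInf_lt hne hb₁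
  have hcont := (continuousAt_mul_c1 hl hc₂ hx).tendsto.mono_left
    (nhdsWithin_le_nhds (s := Set.Ioi x))
  refine ge_of_tendsto hcont ?_
  filter_upwards [Ioo_mem_nhdsGT hy₀.1] with y hy
  have hy0 : 0 < y := hx.trans hy.1
  rw [← thresholdFun_c1Tilde (m := m) hl hc₂ ht hy0]
  refine hloc _ ⟨csInf_le ⟨_, hbelow⟩ ⟨y, ⟨hy.1, hy.2.trans hy₀.2⟩, rfl⟩, ?_⟩
  exact lt_of_le_of_lt (hmono hy0 (hx.trans hy₀.1) hy.2.le) hy₀b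

end ThresholdConstant

/-! ### Integrals of `1 / R` over the event that a null hypothesis is rejected -/

section InverseIntegrals

variable {X : Type*} [MeasurableSpace X] {μ : Measure X}

lemma sum_Ico_one_div_mul {R K : ℕ} (hR : 1 ≤ R) (hRK : R ≤ K) :
    ∑ j ∈ Finset.Ico R K, 1 / ((j : ℝ) * (j + 1)) = 1 / (R : ℝ) - 1 / (K : ℝ) := by
  induction K, hRK using Nat.le_induction with
  | base => simp
  | succ K hK ih =>
    rw [Finset.sum_Ico_succ_top hK, ih]
    have : (0 : ℝ) < K := by exact_mod_cast hR.trans hK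
    push_cast
    field_simp
    ring

/-- The Benjamini–Yekutieli bound: if `w` is `1 / R` on the event that `Z ≤ R α` and `Z ≤ t`, for an
integer `R` that may depend on everything, and `Z` is a null `p`-value, then the integral of `w` is at
most `α` times a harmonic sum. Telescoping `1/j - 1/(j+1)` bounds `w` by the function
`∑_{j<K} 1/(j(j+1)) 1{Z ≤ j α} + 1/K 1{Z ≤ t}`, with `K = ⌈t/α⌉`, of `Z` alone. -/
lemma lintegral_le_of_threshold {Z : X → ℝ} (hZ : Measurable Z)
    (hnull : ∀ a, 0 ≤ a → μ {x | Z x ≤ a} ≤ ENNReal.ofReal a) {α t : ℝ} (hα : 0 < α) (ht : 0 < t)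
    {w : X → ENNReal} (hw : ∀ᵐ x ∂μ, w x ≠ 0 →
      ∃ R : ℕ, 1 ≤ R ∧ w x = ENNReal.ofReal (1 / R) ∧ Z x ≤ R * α ∧ Z x ≤ t) :
    ∫⁻ x, w x ∂μ ≤ ENNReal.ofReal (α * ∑ j ∈ Finset.Icc 1 ⌈t / α⌉₊, 1 / (j : ℝ)) := by
  set K := ⌈t / α⌉₊ with hK
  have hK1 : 1 ≤ K := Nat.one_le_iff_ne_zero.2 (Nat.ceil_pos.2 (by positivity)).ne'
  have hKr : (0 : ℝ) < K := by exact_mod_cast hK1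
  have htK : t ≤ K * α := (div_le_iff₀ hα).1 (Nat.le_ceil _)
  have hmeas : ∀ a, MeasurableSet {x | Z x ≤ a} := fun a => measurableSet_le hZ measurable_const
  have hpt : ∀ᵐ x ∂μ, w x ≤ ∑ j ∈ Finset.Ico 1 K, ENNReal.ofReal (1 / ((j : ℝ) * (j + 1))) *
      Set.indicator {x | Z x ≤ j * α} 1 x +
      ENNReal.ofReal (1 / K) * Set.indicator {x | Z x ≤ t} 1 x := by
    filter_upwards [hw] with x hx
    by_cases h0 : w x = 0
    · simp [h0]
    obtain ⟨R, hR, hwR, hZR, hZt⟩ := hx h0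
    have hRr : (0 : ℝ) < R := by exact_mod_cast hR
    rw [hwR, Set.indicator_of_mem (s := {x | Z x ≤ t}) hZt]
    simp only [Pi.one_apply, mul_one]
    rcases le_total K R with hKR | hRK
    · refine le_add_left (ENNReal.ofReal_le_ofReal ?_)
      exact one_div_le_one_div_of_le hKr (by exact_mod_cast hKR)
    · have hsub : ∑ j ∈ Finset.Ico R K, ENNReal.ofReal (1 / ((j : ℝ) * (j + 1))) ≤
          ∑ j ∈ Finset.Ico 1 K, ENNReal.ofReal (1 / ((j : ℝ) * (j + 1))) *
            Set.indicator {x | Z x ≤ j * α} 1 x := by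
        refine le_trans (le_of_eq (Finset.sum_congr rfl fun j hj => ?_))
          (Finset.sum_le_sum_of_subset (Finset.Ico_subset_Ico_left hR))
        have hRj : (R : ℝ) ≤ j := by exact_mod_cast (Finset.mem_Ico.1 hj).1
        have hmem : x ∈ {x | Z x ≤ j * α} := hZR.trans (by gcongr)
        rw [Set.indicator_of_mem hmem]
        simp
      refine le_trans (le_of_eq ?_) (add_le_add_left hsub _)
      rw [← ENNReal.ofReal_sum_of_nonneg (fun j _ => by positivity), sum_Ico_one_div_mul hR hRK,
        ← ENNReal.ofReal_add (sub_nonneg.2 (one_div_le_one_div_of_le hRr (by exact_mod_cast hRK)))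
          (by positivity)]
      congr 1
      ring
  refine (lintegral_mono_ae hpt).trans ?_
  have hind : ∀ a, Measurable (Set.indicator {x | Z x ≤ a} (1 : X → ENNReal)) := fun a =>
    measurable_one.indicator (hmeas a)
  rw [lintegral_add_right _ ((hind t).const_mul _),
    lintegral_finsetSum _ (fun j _ => (hind _).const_mul _)]
  simp_rw [lintegral_const_mul _ (hind _), lintegral_indicator_one (hmeas _)]
  calc _ ≤ ∑ j ∈ Finset.Ico 1 K, ENNReal.ofReal (1 / ((j : ℝ) * (j + 1))) *
          ENNReal.ofReal (j * α) + ENNReal.ofReal (1 / K) * ENNReal.ofReal t := by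
        gcongr with j hj
        · exact hnull _ (by positivity)
        · exact hnull _ ht.le
    _ = ENNReal.ofReal (∑ j ∈ Finset.Ico 1 K, 1 / ((j : ℝ) * (j + 1)) * (j * α) + 1 / K * t) := by
        rw [ENNReal.ofReal_add (Finset.sum_nonneg fun j _ => by positivity) (by positivity),
          ENNReal.ofReal_sum_of_nonneg (fun j _ => by positivity),
          ENNReal.ofReal_mul (by positivity)]
        congr 1
        exact Finset.sum_congr rfl fun j _ => (ENNReal.ofReal_mul (by positivity)).symm
    _ ≤ _ := by
        refine ENNReal.ofReal_le_ofReal ?_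
        have h1 : 1 / (K : ℝ) * t ≤ α := by
          rw [one_div_mul_eq_div, div_le_iff₀ hKr]; linarith
        have h2 : ∑ j ∈ Finset.Ico 1 K, 1 / ((j : ℝ) * (j + 1)) * (j * α) =
            α * ∑ j ∈ Finset.Ico 1 K, 1 / ((j + 1 : ℕ) : ℝ) := by
          rw [Finset.mul_sum]
          refine Finset.sum_congr rfl fun j hj => ?_
          have : (0 : ℝ) < j := by exact_mod_cast (Finset.mem_Ico.1 hj).1
          push_cast
          field_simp
        have h3 : ∑ j ∈ Finset.Icc 1 K, 1 / (j : ℝ) =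
            1 + ∑ j ∈ Finset.Ico 1 K, 1 / ((j + 1 : ℕ) : ℝ) := by
          rw [Finset.sum_Ico_add' (fun i : ℕ => 1 / (i : ℝ)) 1 K 1,
            ← Finset.Ico_add_one_right_eq_Icc, Finset.sum_eq_sum_Ico_succ_bot (by omega)]
          simp
        rw [h2, h3]
        linarith

end InverseIntegrals

section Dependence

variable {m : ℕ}

/-- The form in which positive dependence is used: the conditional probability
`Pr(p ∈ D | p i ≤ a)` of an increasing event is nondecreasing in `a` (written without division). -/
def ConditionallyIncreasing (μ : Measure (Fin m → ℝ)) (i : Fin m) : Prop :=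
  ∀ D : Set (Fin m → ℝ), MeasurableSet D → IsUpperSet D → ∀ a b : ℝ, a ≤ b →
    μ.real (D ∩ {p | p i ≤ a}) * μ.real {p | p i ≤ b} ≤
      μ.real (D ∩ {p | p i ≤ b}) * μ.real {p | p i ≤ a}

lemma measureReal_le_split (μ : Measure (Fin m → ℝ)) [IsFiniteMeasure μ] (i : Fin m)
    (D : Set (Fin m → ℝ)) {a b : ℝ} (hab : a ≤ b) :
    μ.real (D ∩ {p | p i ≤ b}) =
      μ.real (D ∩ {p | p i ≤ a}) + μ.real (D ∩ {p | p i ∈ Set.Ioc a b}) := by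
  have hm : MeasurableSet {p : Fin m → ℝ | p i ≤ a} :=
    measurableSet_le (measurable_pi_apply i) measurable_const
  rw [← measureReal_inter_add_sdiff (s := D ∩ {p | p i ≤ b}) hm]
  congr 2
  · ext p
    simp only [Set.mem_inter_iff, Set.mem_ofPred_eq]
    exact ⟨fun h => ⟨h.1.1, h.2⟩, fun h => ⟨⟨h.1, h.2.trans hab⟩, h.2⟩⟩
  · ext p
    simp only [Set.mem_inter_iff, Set.mem_sdiff, Set.mem_ofPred_eq, Set.mem_Ioc, not_le]
    tauto

/-- It suffices to separate the conditional probabilities below `a` and above `a` by a number. -/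
lemma conditionallyIncreasing_of_exists {μ : Measure (Fin m → ℝ)} [IsFiniteMeasure μ] {i : Fin m}
    (h : ∀ D : Set (Fin m → ℝ), MeasurableSet D → IsUpperSet D → ∀ a : ℝ, ∃ κ : ℝ,
      μ.real (D ∩ {p | p i ≤ a}) ≤ κ * μ.real {p | p i ≤ a} ∧
      ∀ b, κ * μ.real {p | p i ∈ Set.Ioc a b} ≤ μ.real (D ∩ {p | p i ∈ Set.Ioc a b})) :
    ConditionallyIncreasing μ i := by
  intro D hD hup a b hab
  obtain ⟨κ, h1, h2⟩ := h D hD hup a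
  have e1 := measureReal_le_split μ i D hab
  have e2 := measureReal_le_split μ i Set.univ hab
  simp only [Set.univ_inter] at e2
  rw [e1, e2]
  have h3 := mul_le_mul_of_nonneg_right h1
    (measureReal_nonneg (μ := μ) (s := {p | p i ∈ Set.Ioc a b}))
  have h4 := mul_le_mul_of_nonneg_right (h2 b) (measureReal_nonneg (μ := μ) (s := {p | p i ≤ a}))
  nlinarith

/-- Resampling one coordinate of a product measure independently does not change the measure. -/
lemma measurePreserving_update (ν : Fin m → Measure ℝ) [∀ i, IsProbabilityMeasure (ν i)]
    (i : Fin m) : MeasurePreserving (fun z : (Fin m → ℝ) × ℝ => Function.update z.1 i z.2)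
      ((Measure.pi ν).prod (ν i)) (Measure.pi ν) := by
  refine ⟨measurable_update', (Measure.pi_eq fun s hs => ?_).symm⟩
  rw [Measure.map_apply measurable_update' (MeasurableSet.univ_pi hs)]
  have hset : (fun z : (Fin m → ℝ) × ℝ => Function.update z.1 i z.2) ⁻¹' Set.univ.pi s =
      (Set.univ.pi (Function.update s i Set.univ)) ×ˢ s i := by
    ext ⟨p, x⟩
    simp only [Set.mem_preimage, Set.mem_univ_pi, Set.mem_prod]
    constructor
    · intro h
      refine ⟨fun j => ?_, by simpa using h i⟩
      by_cases hj : j = i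
      · subst hj; simp
      · simpa [hj] using h j
    · rintro ⟨h, hx⟩ j
      by_cases hj : j = i
      · subst hj; simpa using hx
      · simpa [hj] using h j
  rw [hset, Measure.prod_prod, Measure.pi_pi, ← Finset.mul_prod_erase _ _ (Finset.mem_univ i),
    ← Finset.mul_prod_erase Finset.univ (fun j => ν j (s j)) (Finset.mem_univ i)]
  simp only [Function.update_self, measure_univ, one_mul]
  rw [mul_comm]
  congr 1
  refine Finset.prod_congr rfl fun j hj => ?_
  rw [Function.update_of_ne (Finset.ne_of_mem_erase hj)]

lemma conditionallyIncreasing_pi (ν : Fin m → Measure ℝ) [∀ i, IsProbabilityMeasure (ν i)]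
    (i : Fin m) : ConditionallyIncreasing (Measure.pi ν) i := by
  refine conditionallyIncreasing_of_exists fun D hD hup a => ?_
  have hmp := measurePreserving_update ν i
  set U := {p : Fin m → ℝ | Function.update p i a ∈ D} with hU
  have hcoord : ∀ B : Set ℝ, MeasurableSet B → MeasurableSet {p : Fin m → ℝ | p i ∈ B} :=
    fun B hB => measurable_pi_apply i hB
  have hmarg : ∀ B : Set ℝ, MeasurableSet B → (Measure.pi ν).real {p | p i ∈ B} = (ν i).real B :=
    fun B hB => by
      rw [measureReal_def, measureReal_def,
        ← (measurePreserving_eval ν i).measure_preimage hB.nullMeasurableSet]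
      rfl
  have hjoint : ∀ B : Set ℝ, MeasurableSet B → (Measure.pi ν).real (D ∩ {p | p i ∈ B}) =
      ((Measure.pi ν).prod (ν i)).real {z | Function.update z.1 i z.2 ∈ D ∧ z.2 ∈ B} :=
    fun B hB => by
      rw [measureReal_def, measureReal_def,
        ← hmp.measure_preimage (hD.inter (hcoord B hB)).nullMeasurableSet]
      congr 2
      ext z
      simp
  refine ⟨(Measure.pi ν).real U, ?_, fun b => ?_⟩
  · rw [show {p : Fin m → ℝ | p i ≤ a} = {p | p i ∈ Set.Iic a} from rfl,
      hjoint _ measurableSet_Iic, hmarg _ measurableSet_Iic, ← measureReal_prod_prod]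
    refine measureReal_mono ?_
    rintro ⟨p, x⟩ ⟨hz, hx⟩
    exact ⟨hup (update_le_update_iff'.2 hx) hz, hx⟩
  · rw [hjoint _ measurableSet_Ioc, hmarg _ measurableSet_Ioc, ← measureReal_prod_prod]
    refine measureReal_mono ?_
    rintro ⟨p, x⟩ ⟨hz, hx⟩
    exact ⟨hup (update_le_update_iff'.2 hx.1.le) hz, hx⟩

lemma PRDS.conditionallyIncreasing {Ω : Type*} [MeasurableSpace Ω] {μ : Measure Ω}
    [IsProbabilityMeasure μ] {P : Fin m → Ω → ℝ} (hP : ∀ i, Measurable (P i)) {N : Finset (Fin m)}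
    (h : PRDS μ P N) {i : Fin m} (hi : i ∈ N) :
    ConditionallyIncreasing (μ.map fun ω k => P k ω) i := by
  have hPm : Measurable fun ω k => P k ω := measurable_pi_lambda _ hP
  have := Measure.isProbabilityMeasure_map (μ := μ) hPm.aemeasurable
  refine conditionallyIncreasing_of_exists fun D hD hup a => ?_
  obtain ⟨g, hg, hcond⟩ := h D hD hup i hi
  set E := {ω | (fun k => P k ω) ∈ D} with hE
  have hEm : MeasurableSet E := hPm hD
  have hle : MeasurableSpace.comap (P i) inferInstance ≤ ‹MeasurableSpace Ω› := (hP i).comap_le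
  have hint : Integrable (Set.indicator E fun _ => (1 : ℝ)) μ :=
    (integrable_const 1).indicator hEm
  have hgint : Integrable (fun ω => g (P i ω)) μ := integrable_condExp.congr hcond
  have hcoord : ∀ B : Set ℝ, MeasurableSet B → (μ.map fun ω k => P k ω).real {p | p i ∈ B} =
      μ.real (P i ⁻¹' B) := fun B hB => by
    rw [map_measureReal_apply (s := {p | p i ∈ B}) hPm (measurable_pi_apply i hB)]
    rfl
  have hjoint : ∀ B : Set ℝ, MeasurableSet B →
      (μ.map fun ω k => P k ω).real (D ∩ {p | p i ∈ B}) = ∫ ω in P i ⁻¹' B, g (P i ω) ∂μ :=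
    fun B hB => by
      rw [map_measureReal_apply (s := D ∩ {p | p i ∈ B}) hPm
        (hD.inter (measurable_pi_apply i hB)),
        ← integral_congr_ae (ae_restrict_of_ae hcond),
        setIntegral_condExp hle hint ⟨B, hB, rfl⟩, setIntegral_indicator hEm]
      simp only [integral_const, smul_eq_mul, mul_one, measureReal_restrict_apply_univ]
      rw [Set.inter_comm]
      rfl
  have hconst : ∀ B : Set ℝ, ∫ _ in P i ⁻¹' B, g a ∂μ = g a * μ.real (P i ⁻¹' B) := fun B => by
    simp [mul_comm]
  refine ⟨g a, ?_, fun b => ?_⟩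
  · rw [show {p : Fin m → ℝ | p i ≤ a} = {p | p i ∈ Set.Iic a} from rfl,
      hjoint _ measurableSet_Iic, hcoord _ measurableSet_Iic, ← hconst]
    exact setIntegral_mono_on hgint.integrableOn (integrable_const _).integrableOn
      (hP i measurableSet_Iic) fun ω hω => hg hω
  · rw [hjoint _ measurableSet_Ioc, hcoord _ measurableSet_Ioc, ← hconst]
    exact setIntegral_mono_on (integrable_const _).integrableOn hgint.integrableOn
      (hP i measurableSet_Ioc) fun ω hω => hg hω.1.le

/-- The PRDS lemma of Benjamini and Yekutieli: if `R` is a nonincreasing function of the `p`-values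
and `w` is `1 / R` on the event `p i ≤ R β`, for a null `p`-value `p i`, then the integral of `w` is at
most `β`. With `a k = Pr(R ≤ k | p i ≤ k β)`, the part of the integral where `R = k + 1` is at most
`β (a (k + 1) - a k)`, and the sum over `k` telescopes. -/
lemma ConditionallyIncreasing.lintegral_le {μ : Measure (Fin m → ℝ)} [IsProbabilityMeasure μ]
    {i : Fin m} (h : ConditionallyIncreasing μ i)
    (hnull : ∀ a, 0 ≤ a → μ {p | p i ≤ a} ≤ ENNReal.ofReal a) {β : ℝ} (hβ : 0 ≤ β) {K : ℕ}
    {R : (Fin m → ℝ) → ℕ} (hRmeas : Measurable R) (hRanti : Antitone R) (hRK : ∀ p, R p ≤ K)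
    {w : (Fin m → ℝ) → ENNReal}
    (hw : ∀ p, w p ≠ 0 → 1 ≤ R p ∧ w p = ENNReal.ofReal (1 / R p) ∧ p i ≤ R p * β) :
    ∫⁻ p, w p ∂μ ≤ ENNReal.ofReal β := by
  have hcoord : ∀ a : ℝ, MeasurableSet {p : Fin m → ℝ | p i ≤ a} := fun a =>
    measurableSet_le (measurable_pi_apply i) measurable_const
  have hRle : ∀ k, MeasurableSet {p | R p ≤ k} := fun k => measurableSet_le hRmeas measurable_const
  have hup : ∀ k, IsUpperSet {p | R p ≤ k} := fun k p p' hpp' hp => (hRanti hpp').trans hp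
  set E : ℕ → Set (Fin m → ℝ) := fun k => {p | R p = k} ∩ {p | p i ≤ k * β} with hE
  have hEmeas : ∀ k, MeasurableSet (E k) := fun k =>
    (hRmeas (measurableSet_singleton k)).inter (hcoord _)
  set F : ℕ → ℝ := fun k => μ.real {p | p i ≤ k * β} with hF
  set L : ℕ → ℝ := fun k => μ.real ({p | R p ≤ k} ∩ {p | p i ≤ k * β}) with hL
  have hF0 : ∀ k, 0 ≤ F k := fun k => measureReal_nonneg
  have hL0 : ∀ k, 0 ≤ L k := fun k => measureReal_nonneg
  have hLF : ∀ k, L k ≤ F k := fun k => measureReal_mono Set.inter_subset_right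
  have hFle : ∀ k : ℕ, F k ≤ k * β := fun k =>
    ENNReal.toReal_le_of_le_ofReal (by positivity) (hnull _ (by positivity))
  have hpt : ∀ p, w p ≤ ∑ k ∈ Finset.range K, ENNReal.ofReal (1 / ((k : ℝ) + 1)) *
      Set.indicator (E (k + 1)) 1 p := by
    intro p
    by_cases h0 : w p = 0
    · simp [h0]
    obtain ⟨hR, hwR, hp⟩ := hw p h0
    have hmem : R p - 1 ∈ Finset.range K := by
      have := hRK p
      simp only [Finset.mem_range]
      omega
    refine le_trans (le_of_eq ?_) (Finset.single_le_sum (fun _ _ => zero_le) hmem)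
    have hR' : R p - 1 + 1 = R p := by omega
    have hcast : (((R p - 1 : ℕ) : ℝ) + 1) = R p := by exact_mod_cast hR'
    have hpE : p ∈ E (R p - 1 + 1) := by
      rw [hR']
      exact ⟨rfl, hp⟩
    rw [Set.indicator_of_mem hpE, hcast, hwR]
    simp
  have hterm : ∀ k : ℕ, 1 / ((k : ℝ) + 1) * μ.real (E (k + 1)) ≤
      β * (L (k + 1) / F (k + 1) - L k / F k) := by
    intro k
    have hkβ : (k : ℝ) * β ≤ ((k + 1 : ℕ) : ℝ) * β := by gcongr; simp
    set L' := μ.real ({p | R p ≤ k} ∩ {p | p i ≤ ((k + 1 : ℕ) : ℝ) * β}) with hL'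
    have hEeq : μ.real (E (k + 1)) = L (k + 1) - L' := by
      have hsplit := measureReal_inter_add_sdiff (μ := μ)
        (s := {p | R p ≤ k + 1} ∩ {p | p i ≤ ((k + 1 : ℕ) : ℝ) * β}) (hRle k)
      have e1 : ({p | R p ≤ k + 1} ∩ {p | p i ≤ ((k + 1 : ℕ) : ℝ) * β}) ∩ {p | R p ≤ k} =
          {p | R p ≤ k} ∩ {p | p i ≤ ((k + 1 : ℕ) : ℝ) * β} := by
        ext p
        simp only [Set.mem_inter_iff, Set.mem_ofPred_eq]
        exact ⟨fun h => ⟨h.2, h.1.2⟩, fun h => ⟨⟨by omega, h.2⟩, h.1⟩⟩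
      have e2 : ({p | R p ≤ k + 1} ∩ {p | p i ≤ ((k + 1 : ℕ) : ℝ) * β}) \ {p | R p ≤ k} =
          E (k + 1) := by
        ext p
        simp only [hE, Set.mem_inter_iff, Set.mem_sdiff, Set.mem_ofPred_eq]
        exact ⟨fun h => ⟨by omega, h.1.2⟩, fun h => ⟨⟨by omega, h.2⟩, by omega⟩⟩
      rw [e1, e2] at hsplit
      simp only [hL, hL']
      linarith
    have hratio : L k * F (k + 1) ≤ L' * F k := h _ (hRle k) (hup k) _ _ hkβ
    have hFmono : F k ≤ F (k + 1) := measureReal_mono fun p hp => le_trans hp hkβ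
    have hE0 : 0 ≤ μ.real (E (k + 1)) := measureReal_nonneg
    rcases (hF0 (k + 1)).eq_or_lt with hz | hpos
    · have hk0 : F k = 0 := le_antisymm (hz ▸ hFmono) (hF0 k)
      have : L (k + 1) = 0 := le_antisymm (hz ▸ hLF (k + 1)) (hL0 _)
      have hL'0 : 0 ≤ L' := measureReal_nonneg
      have hE' : μ.real (E (k + 1)) = 0 := by linarith
      rw [hE', ← hz, hk0]
      simp
    · have hL'le : L k / F k ≤ L' / F (k + 1) := by
        rcases (hF0 k).eq_or_lt with hz | hposk
        · rw [← hz, div_zero]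
          exact div_nonneg measureReal_nonneg hpos.le
        · rwa [div_le_div_iff₀ hposk hpos]
      have hk1 : (0 : ℝ) < (k : ℝ) + 1 := by positivity
      calc 1 / ((k : ℝ) + 1) * μ.real (E (k + 1))
          = F (k + 1) / ((k : ℝ) + 1) * (μ.real (E (k + 1)) / F (k + 1)) := by field_simp
        _ ≤ β * (μ.real (E (k + 1)) / F (k + 1)) := by
            gcongr
            rw [div_le_iff₀ hk1]
            have := hFle (k + 1)
            push_cast at this
            linarith
        _ ≤ β * (L (k + 1) / F (k + 1) - L k / F k) := by
            gcongr
            rw [hEeq, sub_div]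
            linarith
  calc ∫⁻ p, w p ∂μ ≤ ∫⁻ p, ∑ k ∈ Finset.range K, ENNReal.ofReal (1 / ((k : ℝ) + 1)) *
        Set.indicator (E (k + 1)) 1 p ∂μ := lintegral_mono hpt
    _ = ∑ k ∈ Finset.range K, ENNReal.ofReal (1 / ((k : ℝ) + 1)) * μ (E (k + 1)) := by
        have hind : ∀ k, Measurable (Set.indicator (E k) (1 : (Fin m → ℝ) → ENNReal)) := fun k =>
          measurable_one.indicator (hEmeas k)
        rw [lintegral_finsetSum _ fun k _ => (hind _).const_mul _]
        simp_rw [lintegral_const_mul _ (hind _), lintegral_indicator_one (hEmeas _)]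
    _ = ENNReal.ofReal (∑ k ∈ Finset.range K, 1 / ((k : ℝ) + 1) * μ.real (E (k + 1))) := by
        rw [ENNReal.ofReal_sum_of_nonneg fun k _ => by positivity]
        refine Finset.sum_congr rfl fun k _ => ?_
        rw [ENNReal.ofReal_mul (by positivity), ofReal_measureReal]
    _ ≤ ENNReal.ofReal β := by
        refine ENNReal.ofReal_le_ofReal ((Finset.sum_le_sum fun k _ => hterm k).trans ?_)
        rw [← Finset.mul_sum, Finset.sum_range_sub (fun k => L k / F k)]
        have h1 : L K / F K ≤ 1 := div_le_one_of_le₀ (hLF K) (hF0 K)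
        have h2 : 0 ≤ L 0 / F 0 := div_nonneg (hL0 0) (hF0 0)
        exact mul_le_of_le_one_right hβ (by linarith)

end Dependence

/-! ### The false discovery rate of the step-up procedure -/

section FalseDiscoveryRate

variable {m : ℕ}

/-- The contribution `1{i ∈ D} / |D|` of the feature `i` to the proportion of false claims. -/
noncomputable def weight (D : Finset (Fin m)) (i : Fin m) : ℝ := if i ∈ D then 1 / (D.card : ℝ) else 0

lemma weight_nonneg (D : Finset (Fin m)) (i : Fin m) : 0 ≤ weight D i := by
  unfold weight; split_ifs <;> positivity

lemma sum_weight (D N : Finset (Fin m)) :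
    ∑ i ∈ N, weight D i = ((D ∩ N).card : ℝ) / max (D.card : ℝ) 1 := by
  simp only [weight]
  rw [← Finset.sum_filter, Finset.filter_mem_eq_inter, Finset.inter_comm, Finset.sum_const,
    nsmul_eq_mul, mul_one_div]
  rcases D.eq_empty_or_nonempty with rfl | hD
  · simp
  · rw [max_eq_left]
    exact_mod_cast hD.card_pos

lemma fdp_eq (N₁ N₂ D : Finset (Fin m)) : fdp N₁ N₂ D = ∑ i ∈ N₁ ∩ N₂, weight D i +
    ∑ i ∈ N₁ \ N₂, weight D i + ∑ i ∈ N₂ \ N₁, weight D i := by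
  rw [sum_weight, sum_weight, sum_weight, fdp, add_div, add_div]

lemma fdp_nonneg (N₁ N₂ D : Finset (Fin m)) : 0 ≤ fdp N₁ N₂ D := by
  unfold fdp; positivity

lemma fdp_le_one (N₁ N₂ D : Finset (Fin m)) : fdp N₁ N₂ D ≤ 1 := by
  unfold fdp
  rw [div_le_one (by positivity)]
  refine le_trans ?_ (le_max_left _ _)
  have h1 : Disjoint (D ∩ (N₁ ∩ N₂)) (D ∩ (N₁ \ N₂)) :=
    Finset.disjoint_left.2 fun a ha hb => by simp at ha hb; tauto
  have h2 : Disjoint (D ∩ (N₁ ∩ N₂) ∪ D ∩ (N₁ \ N₂)) (D ∩ (N₂ \ N₁)) :=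
    Finset.disjoint_left.2 fun a ha hb => by simp at ha hb; tauto
  rw [← Nat.cast_add, ← Nat.cast_add, ← Finset.card_union_of_disjoint h1,
    ← Finset.card_union_of_disjoint h2]
  exact_mod_cast Finset.card_le_card fun a ha => by simp at ha; tauto

/-- Every function of a random set of features is measurable if the events `i ∈ D` are. -/
lemma measurable_comp_finset {X β : Type*} [MeasurableSpace X] [MeasurableSpace β]
    {D : X → Finset (Fin m)} (hD : ∀ i, MeasurableSet {x | i ∈ D x}) (F : Finset (Fin m) → β) :
    Measurable fun x => F (D x) := by
  intro B _
  have hset : (fun x => F (D x)) ⁻¹' B = ⋃ s ∈ {s | F s ∈ B}, ⋂ i, {x | i ∈ D x ↔ i ∈ s} := by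
    ext x
    simp only [Set.mem_preimage, Set.mem_iUnion, Set.mem_iInter, Set.mem_ofPred_eq, exists_prop]
    constructor
    · exact fun h => ⟨D x, h, fun _ => Iff.rfl⟩
    · rintro ⟨s, hs, h⟩
      rwa [Finset.ext h]
  rw [hset]
  refine MeasurableSet.biUnion (Set.to_countable _) fun s _ => MeasurableSet.iInter fun i => ?_
  by_cases his : i ∈ s
  · simpa [his] using hD i
  · simp only [his, iff_false]
    exact (hD i).compl

/-- The rejection set of the two-study procedure: the slopes are `α` for the primary `p`-values and
`b / |S p₁|` for the follow-up `p`-values of the selected features. -/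
noncomputable def twoStudyRejection (S : (Fin m → ℝ) → Finset (Fin m)) (α b : ℝ)
    (p₁ p₂ : Fin m → ℝ) : Finset (Fin m) :=
  rejection (S p₁) α (b / (S p₁).card) p₁ p₂

variable {S : (Fin m → ℝ) → Finset (Fin m)} {α b : ℝ}

lemma measurableSet_mem_twoStudyRejection (hS : MeasurableRule S) (i : Fin m) :
    MeasurableSet {z : (Fin m → ℝ) × (Fin m → ℝ) | i ∈ twoStudyRejection S α b z.1 z.2} := by
  have hset : {z : (Fin m → ℝ) × (Fin m → ℝ) | i ∈ twoStudyRejection S α b z.1 z.2} =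
      ⋃ s : Finset (Fin m), ⋃ A ∈ {A : Finset (Fin m) | A ⊆ s ∧ i ∈ A},
        {z | S z.1 = s} ∩ ⋂ j ∈ A, {z | z.1 j ≤ A.card * α ∧ z.2 j ≤ A.card * (b / s.card)} := by
    ext z
    simp only [twoStudyRejection, mem_rejection, SelfConsistent, Set.mem_iUnion, Set.mem_iInter,
      Set.mem_inter_iff, Set.mem_ofPred_eq, exists_prop]
    constructor
    · rintro ⟨A, hA, hiA, h⟩
      exact ⟨_, A, ⟨hA, hiA⟩, rfl, h⟩
    · rintro ⟨s, A, ⟨hA, hiA⟩, rfl, h⟩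
      exact ⟨A, hA, hiA, h⟩
  rw [hset]
  refine MeasurableSet.iUnion fun s => MeasurableSet.biUnion (Set.to_countable _) fun A _ => ?_
  refine MeasurableSet.inter ?_ (MeasurableSet.biInter A.countable_toSet fun j _ => ?_)
  · exact measurableSet_setOfPred.2
      (measurable_comp_finset (fun j => measurable_fst (hS j)) fun t => t = s)
  · exact (measurableSet_le (f := fun z : (Fin m → ℝ) × (Fin m → ℝ) => z.1 j) (by fun_prop)
      measurable_const).inter (measurableSet_le (f := fun z : (Fin m → ℝ) × (Fin m → ℝ) => z.2 j)
        (by fun_prop) measurable_const)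

lemma measurable_weight (hS : MeasurableRule S) (i : Fin m) :
    Measurable fun z : (Fin m → ℝ) × (Fin m → ℝ) =>
      ENNReal.ofReal (weight (twoStudyRejection S α b z.1 z.2) i) :=
  measurable_comp_finset (measurableSet_mem_twoStudyRejection hS) fun D =>
    ENNReal.ofReal (weight D i)

/-- A nonzero weight is `1 / R` for the number `R` of rejections, and the two `p`-values lie below
the corresponding thresholds. -/
lemma weight_ne_zero (hα : 0 ≤ α) (hb : 0 ≤ b) {p₁ p₂ : Fin m → ℝ} {i : Fin m}
    (h : ENNReal.ofReal (weight (twoStudyRejection S α b p₁ p₂) i) ≠ 0) :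
    i ∈ S p₁ ∧ i ∈ twoStudyRejection S α b p₁ p₂ ∧
      1 ≤ (twoStudyRejection S α b p₁ p₂).card ∧
      ENNReal.ofReal (weight (twoStudyRejection S α b p₁ p₂) i) =
        ENNReal.ofReal (1 / (twoStudyRejection S α b p₁ p₂).card) ∧
      p₁ i ≤ (twoStudyRejection S α b p₁ p₂).card * α ∧
      p₂ i ≤ (twoStudyRejection S α b p₁ p₂).card * (b / (S p₁).card) := by
  have hi : i ∈ twoStudyRejection S α b p₁ p₂ := by
    by_contra hi
    simp [weight, hi] at h
  have hsc := selfConsistent_rejection (s := S p₁) (p₁ := p₁) (p₂ := p₂) hα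
    (β := b / (S p₁).card) (by positivity) i hi
  exact ⟨rejection_subset hi, hi, Finset.card_pos.2 ⟨i, hi⟩, by simp [weight, hi], hsc.1, hsc.2⟩

/-- The follow-up `p`-value of a rejected feature is at most `b`, since at most all selected features
are rejected. -/
lemma le_of_weight_ne_zero (hα : 0 ≤ α) (hb : 0 ≤ b) {p₁ p₂ : Fin m → ℝ} {i : Fin m}
    (h : ENNReal.ofReal (weight (twoStudyRejection S α b p₁ p₂) i) ≠ 0) : p₂ i ≤ b := by
  obtain ⟨hi, -, -, -, -, h2⟩ := weight_ne_zero hα hb h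
  have hs : (0 : ℝ) < (S p₁).card := by exact_mod_cast Finset.card_pos.2 ⟨i, hi⟩
  have hle : ((twoStudyRejection S α b p₁ p₂).card : ℝ) ≤ (S p₁).card := by
    exact_mod_cast Finset.card_le_card rejection_subset
  calc p₂ i ≤ (twoStudyRejection S α b p₁ p₂).card * (b / (S p₁).card) := h2
    _ ≤ (S p₁).card * (b / (S p₁).card) := by gcongr
    _ = b := by field_simp

/-- Independent primary `p`-values: the bound for a feature that is null in the primary study. With
all coordinates but `i` fixed, stability makes the selected set `s` the same whenever `i` is selected,
so that whenever `i` is rejected, the number of rejections is a number `R` that does not depend on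
the `i`-th primary `p`-value, and this `p`-value is at most `R α`. -/
lemma lintegral_weight_le_of_pi (hS : MeasurableRule S) (hstable : StableRule S) (hα : 0 ≤ α)
    (hb : 0 ≤ b) (ν : Fin m → Measure ℝ) [∀ i, IsProbabilityMeasure (ν i)]
    (hmem : ∀ i, ∀ᵐ x ∂ν i, x ∈ Set.Ioc (0 : ℝ) 1) {i : Fin m}
    (hnull : ∀ a, 0 ≤ a → ν i (Set.Iic a) ≤ ENNReal.ofReal a) (p₂ : Fin m → ℝ) :
    ∫⁻ p₁, ENNReal.ofReal (weight (twoStudyRejection S α b p₁ p₂) i) ∂Measure.pi ν ≤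
      ENNReal.ofReal α := by
  have hmeas : Measurable fun p₁ : Fin m → ℝ =>
      ENNReal.ofReal (weight (twoStudyRejection S α b p₁ p₂) i) := by
    have hpair : Measurable fun p₁ : Fin m → ℝ => (p₁, p₂) := measurable_prodMk_right
    have hcomp := (measurable_weight (α := α) (b := b) hS i).comp hpair
    simpa only [Function.comp_def] using hcomp
  have hmeas' : Measurable fun z : (Fin m → ℝ) × ℝ => ENNReal.ofReal
      (weight (twoStudyRejection S α b (Function.update z.1 i z.2) p₂) i) :=
    hmeas.comp measurable_update'
  have hmp := (measurePreserving_update ν i).lintegral_comp hmeas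
  rw [← hmp, lintegral_prod _ hmeas'.aemeasurable]
  have hPV : ∀ᵐ p ∂Measure.pi ν, p ∈ PVector m :=
    ae_all_iff.2 fun j => (measurePreserving_eval ν j).quasiMeasurePreserving.ae (hmem j)
  have hinner : ∀ᵐ p ∂Measure.pi ν, ∫⁻ x, ENNReal.ofReal
      (weight (twoStudyRejection S α b (Function.update p i x) p₂) i) ∂ν i ≤ ENNReal.ofReal α := by
    filter_upwards [hPV] with p hp
    have hup : ∀ x ∈ Set.Ioc (0 : ℝ) 1, Function.update p i x ∈ PVector m := fun x hx j => by
      by_cases hj : j = i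
      · subst hj; simpa using hx
      · simpa [hj] using hp j
    obtain ⟨R, hR⟩ : ∃ R : ℕ, ∀ x ∈ Set.Ioc (0 : ℝ) 1, ENNReal.ofReal
        (weight (twoStudyRejection S α b (Function.update p i x) p₂) i) ≤
          ENNReal.ofReal (1 / R) * Set.indicator (Set.Iic (R * α)) 1 x := by
      by_cases hex : ∃ x₀ ∈ Set.Ioc (0 : ℝ) 1, i ∈ S (Function.update p i x₀)
      · obtain ⟨x₀, hx₀, hix₀⟩ := hex
        set s := S (Function.update p i x₀) with hs
        refine ⟨(rejection s α (b / s.card) (Function.update p i 0) p₂).card, fun x hx => ?_⟩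
        by_cases h0 : ENNReal.ofReal
            (weight (twoStudyRejection S α b (Function.update p i x) p₂) i) = 0
        · rw [h0]; exact zero_le
        obtain ⟨hiS, hi, -, hw, hle, -⟩ := weight_ne_zero hα hb h0
        have hsel : S (Function.update p i x) = s := by
          have := hstable _ (hup x₀ hx₀) i hix₀ x hx
          rw [Function.update_idem] at this
          exact this hiS
        have heq : twoStudyRejection S α b (Function.update p i x) p₂ =
            rejection s α (b / s.card) (Function.update p i 0) p₂ := by
          rw [twoStudyRejection, hsel] at hi ⊢
          exact rejection_update_eq hα (by positivity) hx.1.le hi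
        rw [heq, Function.update_self] at hle
        rw [hw, heq, Set.indicator_of_mem (Set.mem_Iic.2 hle)]
        simp
      · refine ⟨0, fun x hx => ?_⟩
        by_cases h0 : ENNReal.ofReal
            (weight (twoStudyRejection S α b (Function.update p i x) p₂) i) = 0
        · rw [h0]; exact zero_le
        · exact absurd ⟨x, hx, (weight_ne_zero hα hb h0).1⟩ hex
    calc _ ≤ ∫⁻ x, ENNReal.ofReal (1 / R) * Set.indicator (Set.Iic (R * α)) 1 x ∂ν i :=
          lintegral_mono_ae ((hmem i).mono hR)
      _ = ENNReal.ofReal (1 / R) * ν i (Set.Iic (R * α)) := by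
          rw [lintegral_const_mul _ (measurable_one.indicator measurableSet_Iic),
            lintegral_indicator_one measurableSet_Iic]
      _ ≤ ENNReal.ofReal (1 / R) * ENNReal.ofReal (R * α) := by
          gcongr
          exact hnull _ (by positivity)
      _ = ENNReal.ofReal (1 / R * (R * α)) := (ENNReal.ofReal_mul (by positivity)).symm
      _ ≤ ENNReal.ofReal α := by
          refine ENNReal.ofReal_le_ofReal ?_
          rw [← mul_assoc]
          refine mul_le_of_le_one_left hα ?_
          rw [one_div_mul_eq_div]
          exact div_self_le_one _
  calc _ ≤ ∫⁻ _, ENNReal.ofReal α ∂Measure.pi ν := lintegral_mono_ae hinner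
    _ = ENNReal.ofReal α := by simp

/-- Arbitrary dependence among the primary `p`-values: the bound for a feature that is null in the
primary study, if the primary `p`-values of all rejected features are at most `t`. -/
lemma lintegral_weight_le_of_threshold {μ₁ : Measure (Fin m → ℝ)} (hα : 0 < α) (hb : 0 ≤ b) {t : ℝ}
    (ht : 0 < t) {i : Fin m} (hnull : ∀ a, 0 ≤ a → μ₁ {p | p i ≤ a} ≤ ENNReal.ofReal a)
    (p₂ : Fin m → ℝ)
    (hle : ∀ᵐ p₁ ∂μ₁, i ∈ twoStudyRejection S α b p₁ p₂ → p₁ i ≤ t) :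
    ∫⁻ p₁, ENNReal.ofReal (weight (twoStudyRejection S α b p₁ p₂) i) ∂μ₁ ≤
      ENNReal.ofReal (α * ∑ j ∈ Finset.Icc 1 ⌈t / α⌉₊, 1 / (j : ℝ)) := by
  refine lintegral_le_of_threshold (measurable_pi_apply i) hnull hα ht ?_
  filter_upwards [hle] with p₁ hp₁ h0
  obtain ⟨-, hi, h1, hw, h2, -⟩ := weight_ne_zero hα.le hb h0
  exact ⟨_, h1, hw, h2, hp₁ hi⟩

/-- The bound for a feature that is null in the follow-up study, for given primary `p`-values. -/
lemma lintegral_weight_le_followUp (hS : MeasurableRule S) (hα : 0 ≤ α) (hb : 0 ≤ b)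
    {μ₂ : Measure (Fin m → ℝ)} [IsProbabilityMeasure μ₂] {i : Fin m}
    (hdep : ConditionallyIncreasing μ₂ i)
    (hnull : ∀ a, 0 ≤ a → μ₂ {p | p i ≤ a} ≤ ENNReal.ofReal a) (p₁ : Fin m → ℝ) :
    ∫⁻ p₂, ENNReal.ofReal (weight (twoStudyRejection S α b p₁ p₂) i) ∂μ₂ ≤
      ENNReal.ofReal (b / (S p₁).card) := by
  have hmeas : ∀ F : Finset (Fin m) → ℕ, Measurable fun p₂ : Fin m → ℝ =>
      F (twoStudyRejection S α b p₁ p₂) := fun F =>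
    (measurable_comp_finset (measurableSet_mem_twoStudyRejection hS) F).comp
      (measurable_const.prodMk measurable_id)
  refine hdep.lintegral_le hnull (by positivity) (hmeas Finset.card)
    (fun p p' hpp' => Finset.card_le_card (rejection_anti_right hpp'))
    (fun p => Finset.card_le_card rejection_subset) fun p₂ h0 => ?_
  obtain ⟨-, -, h1, hw, -, h2⟩ := weight_ne_zero hα hb h0
  exact ⟨h1, hw, h2⟩

/-- The bound for the false discovery rate. A feature that is null in the primary study only
contributes at most `γ`, one that is null in both studies at most `γ b`, the factor `b` being the
probability that its follow-up `p`-value is at most `b`; and the features that are null in the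
follow-up study only contribute at most `b` altogether, namely `b / |S p₁|` for each selected one. -/
lemma lintegral_fdp_le (hS : MeasurableRule S) (hα : 0 ≤ α) (hb : 0 ≤ b)
    {μ₁ μ₂ : Measure (Fin m → ℝ)} [IsProbabilityMeasure μ₁] [IsProbabilityMeasure μ₂]
    {N₁ N₂ : Finset (Fin m)} {γ : ℝ} (hγ : 0 ≤ γ)
    (h₁ : ∀ i ∈ N₁, ∀ p₂, ∫⁻ p₁, ENNReal.ofReal (weight (twoStudyRejection S α b p₁ p₂) i) ∂μ₁ ≤
      ENNReal.ofReal γ)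
    (hnull : ∀ i ∈ N₂, ∀ a, 0 ≤ a → μ₂ {p | p i ≤ a} ≤ ENNReal.ofReal a)
    (hdep : ∀ i ∈ N₂, ConditionallyIncreasing μ₂ i) :
    ∫⁻ z, ENNReal.ofReal (fdp N₁ N₂ (twoStudyRejection S α b z.1 z.2)) ∂μ₁.prod μ₂ ≤
      ENNReal.ofReal ((N₁ ∩ N₂).card * (γ * b) + (N₁ \ N₂).card * γ + b) := by
  set w : (Fin m → ℝ) × (Fin m → ℝ) → Fin m → ENNReal := fun z i =>
    ENNReal.ofReal (weight (twoStudyRejection S α b z.1 z.2) i) with hw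
  have hwm : ∀ i, Measurable fun z => w z i := fun i => measurable_weight hS i
  have h01 : ∀ i ∈ N₁ \ N₂, ∫⁻ z, w z i ∂μ₁.prod μ₂ ≤ ENNReal.ofReal γ := by
    intro i hi
    rw [lintegral_prod_symm _ (hwm i).aemeasurable]
    calc _ ≤ ∫⁻ _, ENNReal.ofReal γ ∂μ₂ :=
          lintegral_mono fun p₂ => h₁ i (Finset.mem_sdiff.1 hi).1 p₂
      _ = _ := by simp
  have h00 : ∀ i ∈ N₁ ∩ N₂, ∫⁻ z, w z i ∂μ₁.prod μ₂ ≤ ENNReal.ofReal (γ * b) := by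
    intro i hi
    have hm : MeasurableSet {p : Fin m → ℝ | p i ≤ b} :=
      measurableSet_le (measurable_pi_apply i) measurable_const
    rw [lintegral_prod_symm _ (hwm i).aemeasurable]
    calc _ ≤ ∫⁻ p₂, ENNReal.ofReal γ * Set.indicator {p | p i ≤ b} 1 p₂ ∂μ₂ := by
          refine lintegral_mono fun p₂ => ?_
          by_cases hp : p₂ i ≤ b
          · rw [Set.indicator_of_mem (s := {p : Fin m → ℝ | p i ≤ b}) hp]
            simpa using h₁ i (Finset.mem_inter.1 hi).1 p₂
          · refine le_trans (le_of_eq ?_) zero_le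
            refine lintegral_eq_zero_of_ae_eq_zero (.of_forall fun p₁ => ?_)
            by_contra h0
            exact hp (le_of_weight_ne_zero hα hb h0)
      _ = ENNReal.ofReal γ * μ₂ {p | p i ≤ b} := by
          rw [lintegral_const_mul _ (measurable_one.indicator hm), lintegral_indicator_one hm]
      _ ≤ ENNReal.ofReal γ * ENNReal.ofReal b := by
          gcongr
          exact hnull i (Finset.mem_inter.1 hi).2 b hb
      _ = _ := (ENNReal.ofReal_mul hγ).symm
  have h10 : ∫⁻ z, ∑ i ∈ N₂ \ N₁, w z i ∂μ₁.prod μ₂ ≤ ENNReal.ofReal b := by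
    rw [lintegral_prod _ (Finset.measurable_fun_sum _ fun i _ => hwm i).aemeasurable]
    have hin : ∀ p₁, ∫⁻ p₂, ∑ i ∈ N₂ \ N₁, w (p₁, p₂) i ∂μ₂ ≤ ENNReal.ofReal b := by
      intro p₁
      have hwm' : ∀ i, Measurable fun p₂ => w (p₁, p₂) i := fun i =>
        (hwm i).comp (measurable_const.prodMk measurable_id)
      rw [lintegral_finsetSum _ fun i _ => hwm' i]
      calc _ ≤ ∑ i ∈ N₂ \ N₁, if i ∈ S p₁ then ENNReal.ofReal (b / (S p₁).card) else 0 := by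
            refine Finset.sum_le_sum fun i hi => ?_
            have hi2 := (Finset.mem_sdiff.1 hi).1
            split_ifs with hiS
            · exact lintegral_weight_le_followUp hS hα hb (hdep i hi2) (hnull i hi2) p₁
            · refine le_of_eq (lintegral_eq_zero_of_ae_eq_zero (.of_forall fun p₂ => ?_))
              by_contra h0
              exact hiS (weight_ne_zero hα hb h0).1
        _ ≤ ∑ i ∈ S p₁, ENNReal.ofReal (b / (S p₁).card) := by
            rw [← Finset.sum_filter]
            exact Finset.sum_le_sum_of_subset fun i hi => (Finset.mem_filter.1 hi).2
        _ = ENNReal.ofReal ((S p₁).card * (b / (S p₁).card)) := by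
            rw [Finset.sum_const, nsmul_eq_mul, ENNReal.ofReal_mul (by positivity),
              ENNReal.ofReal_natCast]
        _ ≤ ENNReal.ofReal b := by
            refine ENNReal.ofReal_le_ofReal ?_
            rw [← mul_div_assoc, mul_comm, mul_div_assoc]
            exact mul_le_of_le_one_right hb (div_self_le_one _)
    calc _ ≤ ∫⁻ _, ENNReal.ofReal b ∂μ₁ := lintegral_mono hin
      _ = _ := by simp
  have hsplit : ∀ z, ENNReal.ofReal (fdp N₁ N₂ (twoStudyRejection S α b z.1 z.2)) =
      ∑ i ∈ N₁ ∩ N₂, w z i + ∑ i ∈ N₁ \ N₂, w z i + ∑ i ∈ N₂ \ N₁, w z i := by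
    intro z
    have hnn : ∀ N : Finset (Fin m),
        0 ≤ ∑ i ∈ N, weight (twoStudyRejection S α b z.1 z.2) i := fun N =>
      Finset.sum_nonneg fun i _ => weight_nonneg _ _
    rw [fdp_eq, ENNReal.ofReal_add (add_nonneg (hnn _) (hnn _)) (hnn _),
      ENNReal.ofReal_add (hnn _) (hnn _)]
    simp only [hw, ENNReal.ofReal_sum_of_nonneg fun i _ => weight_nonneg _ i]
  have hms : ∀ N : Finset (Fin m), Measurable fun z => ∑ i ∈ N, w z i := fun N =>
    Finset.measurable_fun_sum _ fun i _ => hwm i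
  simp_rw [hsplit]
  rw [lintegral_add_right _ (hms _), lintegral_add_right _ (hms _),
    lintegral_finsetSum _ fun i _ => hwm i, lintegral_finsetSum _ fun i _ => hwm i,
    ENNReal.ofReal_add (by positivity) hb, ENNReal.ofReal_add (by positivity) (by positivity)]
  gcongr
  · refine (Finset.sum_le_card_nsmul _ _ _ h00).trans (le_of_eq ?_)
    rw [nsmul_eq_mul, ENNReal.ofReal_mul (Nat.cast_nonneg _), ENNReal.ofReal_natCast]
  · refine (Finset.sum_le_card_nsmul _ _ _ h01).trans (le_of_eq ?_)
    rw [nsmul_eq_mul, ENNReal.ofReal_mul (by positivity), ENNReal.ofReal_natCast]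

/-- The constant `c₁(q)` is chosen so that the three contributions add up to at most `q`. -/
lemma fdr_bound_le {l₀₀ c₂ q : ℝ} (hl : l₀₀ ∈ Set.Ico (0 : ℝ) 1) (hc₂ : c₂ ∈ Set.Ioo (0 : ℝ) 1)
    (hq : q ∈ Set.Ioo (0 : ℝ) 1) (hm : 0 < m) {N₁ N₂ : Finset (Fin m)}
    (hle : l₀₀ ≤ ((N₁ ∩ N₂).card : ℝ) / (m : ℝ)) :
    ((N₁ ∩ N₂).card : ℝ) * (q * c1 l₀₀ c₂ q / m * (c₂ * q)) +
      (N₁ \ N₂).card * (q * c1 l₀₀ c₂ q / m) + c₂ * q ≤ q := by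
  have hmr : (0 : ℝ) < m := by exact_mod_cast hm
  have hc := c1_pos hl hc₂ hq.1
  have hden : 0 < 1 - l₀₀ * (1 - c₂ * q) := by linarith [c1_denom_pos hl hc₂ hq.1, hl.2]
  have hcq : c₂ * q ≤ 1 := by nlinarith [hc₂.1, hc₂.2, hq.1, hq.2]
  have hcard : ((N₁ ∩ N₂).card : ℝ) + (N₁ \ N₂).card ≤ m := by
    have := Finset.card_le_univ N₁
    rw [Fintype.card_fin, ← Finset.card_inter_add_card_sdiff N₁ N₂] at this
    exact_mod_cast this
  rw [le_div_iff₀ hmr] at hle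
  set n₀ := ((N₁ ∩ N₂).card : ℝ)
  set n₁ := ((N₁ \ N₂).card : ℝ)
  have hkey : n₀ * (c₂ * q) + n₁ ≤ m * (1 - l₀₀ * (1 - c₂ * q)) := by
    nlinarith [mul_le_mul_of_nonneg_right hle (sub_nonneg.2 hcq)]
  have hid : c1 l₀₀ c₂ q * (1 - l₀₀ * (1 - c₂ * q)) = 1 - c₂ := by
    rw [c1]; field_simp
  calc n₀ * (q * c1 l₀₀ c₂ q / m * (c₂ * q)) + n₁ * (q * c1 l₀₀ c₂ q / m) + c₂ * q
      = q * c1 l₀₀ c₂ q / m * (n₀ * (c₂ * q) + n₁) + c₂ * q := by ring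
    _ ≤ q * c1 l₀₀ c₂ q / m * (m * (1 - l₀₀ * (1 - c₂ * q))) + c₂ * q := by
        have := hq.1
        gcongr
    _ = q * (c1 l₀₀ c₂ q * (1 - l₀₀ * (1 - c₂ * q))) + c₂ * q := by field_simp
    _ = q := by rw [hid]; ring

end FalseDiscoveryRate

/-! ### The procedures defined by `r`-values -/

section Procedures

open Filter Topology

variable {m : ℕ} {s : Finset (Fin m)} {i : Fin m} {l₀₀ c₂ : ℝ} {p₁ p₂ : Fin m → ℝ}

lemma fFun_c1_subsingleton {M : ℝ} (hl : l₀₀ ∈ Set.Ico (0 : ℝ) 1) (hc₂ : c₂ ∈ Set.Ioo (0 : ℝ) 1)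
    (hM : 0 < M) (hp₁ : ∀ j, 0 < p₁ j) (hi : i ∈ s) :
    {x | x ∈ Set.Ioo (0 : ℝ) 1 ∧ fFun M (c1 l₀₀ c₂) c₂ s p₁ p₂ i x = x}.Subsingleton := by
  have key : ∀ x ∈ Set.Ioo (0 : ℝ) 1, ∀ y ∈ Set.Ioo (0 : ℝ) 1,
      fFun M (c1 l₀₀ c₂) c₂ s p₁ p₂ i x = x → fFun M (c1 l₀₀ c₂) c₂ s p₁ p₂ i y = y → ¬ x < y :=
    fun x hx y hy hfx hfy hxy =>
      (fFun_lt_of_lt hM hc₂.1 (fun j => (hp₁ j).le) hi (fun x hx => c1_pos hl hc₂ hx.1)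
        ((strictMonoOn_mul_c1 hl hc₂).mono Set.Ioo_subset_Ioi_self) hx hy hxy hfx.le).ne hfy
  rintro x ⟨hx, hfx⟩ y ⟨hy, hfy⟩
  exact le_antisymm (not_lt.1 (key y hy x hx hfy hfx)) (not_lt.1 (key x hx y hy hfx hfy))

/-- The `r`-value is at most `q < 1` exactly if the step-up procedure at level `q` rejects. -/
lemma rValue_c1_le_iff {M q : ℝ} (hl : l₀₀ ∈ Set.Ico (0 : ℝ) 1) (hc₂ : c₂ ∈ Set.Ioo (0 : ℝ) 1)
    (hM : 0 < M) (hp₁ : ∀ j, 0 < p₁ j) (hi : i ∈ s) (hq : q ∈ Set.Ioo (0 : ℝ) 1) :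
    rValue (fFun M (c1 l₀₀ c₂) c₂ s p₁ p₂ i) ≤ q ↔
      i ∈ rejection s (q * c1 l₀₀ c₂ q / M) (c₂ * q / s.card) p₁ p₂ := by
  have hp₁' : ∀ j, 0 ≤ p₁ j := fun j => (hp₁ j).le
  have hc : ∀ x ∈ Set.Ioo (0 : ℝ) 1, 0 < c1 l₀₀ c₂ x := fun x hx => c1_pos hl hc₂ hx.1
  have hmono := (strictMonoOn_mul_c1 hl hc₂).mono
    (fun x (hx : x ∈ Set.Ioo (0 : ℝ) 1) => hx.1)
  have hcont : ∀ x ∈ Set.Ioo (0 : ℝ) 1, ContinuousAt (fun x => x * c1 l₀₀ c₂ x) x :=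
    fun x hx => continuousAt_mul_c1 hl hc₂ hx.1
  rw [← fFun_le_iff hM (hc q hq) hc₂.1 hp₁' hi]
  refine rValue_le_iff hq
    (fun x hx hxq => fFun_le_of_le hM hc₂.1 hp₁' hi hc hmono.monotoneOn hx hq hxq)
    (fun x hx hqx => fFun_lt_of_lt hM hc₂.1 hp₁' hi hc hmono hq hx hqx) fun hfq => ?_
  have hleast := isLeast_fFun_le hM hc₂.1 hp₁ hi hc hmono.monotoneOn
    (fun x hx => c1_le hl hc₂ hx.1) (fun x hx v hv => ?_) ⟨q, hq, hfq⟩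
  · exact ⟨_, hleast.1.1, fFun_eq_of_isLeast hM hc₂.1 hp₁' hi hc hcont hleast⟩
  · refine ge_of_tendsto ((hcont x hx).tendsto.mono_left
      (nhdsWithin_le_nhds (s := Set.Ioi x))) ?_
    filter_upwards [Ioo_mem_nhdsGT hx.2] with y hy using hv y hy

lemma isLeast_fFun_c1Tilde {t : ℝ} (hl : l₀₀ ∈ Set.Ico (0 : ℝ) 1) (hc₂ : c₂ ∈ Set.Ioo (0 : ℝ) 1)
    (ht : 0 ≤ t) (hm : 0 < m) (hp₁ : ∀ j, 0 < p₁ j) (hi : i ∈ s)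
    (hex : ∃ x ∈ Set.Ioo (0 : ℝ) 1, fFun m (c1Tilde m t l₀₀ c₂) c₂ s p₁ p₂ i x ≤ x) :
    IsLeast {x | x ∈ Set.Ioo (0 : ℝ) 1 ∧ fFun m (c1Tilde m t l₀₀ c₂) c₂ s p₁ p₂ i x ≤ x}
      (sInf {x | x ∈ Set.Ioo (0 : ℝ) 1 ∧ fFun m (c1Tilde m t l₀₀ c₂) c₂ s p₁ p₂ i x ≤ x}) :=
  isLeast_fFun_le (by exact_mod_cast hm) hc₂.1 hp₁ hi
    (fun x hx => (c1Tilde_spec hl hc₂ ht hx.1).2.1)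
    ((monotoneOn_mul_c1Tilde hl hc₂ ht).mono Set.Ioo_subset_Ioi_self)
    (fun x hx => c1Tilde_le hl hc₂ ht hx.1)
    (fun x hx v hv => mul_c1Tilde_right_cont hl hc₂ ht hx.1 hx.2 v hv) hex

lemma rValueMin_c1Tilde_le_iff {t q : ℝ} (hl : l₀₀ ∈ Set.Ico (0 : ℝ) 1)
    (hc₂ : c₂ ∈ Set.Ioo (0 : ℝ) 1) (ht : 0 ≤ t) (hm : 0 < m) (hp₁ : ∀ j, 0 < p₁ j) (hi : i ∈ s)
    (hq : q ∈ Set.Ioo (0 : ℝ) 1) :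
    rValueMin (fFun m (c1Tilde m t l₀₀ c₂) c₂ s p₁ p₂ i) ≤ q ↔
      i ∈ rejection s (q * c1Tilde m t l₀₀ c₂ q / m) (c₂ * q / s.card) p₁ p₂ := by
  have hp₁' : ∀ j, 0 ≤ p₁ j := fun j => (hp₁ j).le
  have hM : (0 : ℝ) < m := by exact_mod_cast hm
  have hc : ∀ x ∈ Set.Ioo (0 : ℝ) 1, 0 < c1Tilde m t l₀₀ c₂ x :=
    fun x hx => (c1Tilde_spec hl hc₂ ht hx.1).2.1
  rw [← fFun_le_iff hM (hc q hq) hc₂.1 hp₁' hi]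
  exact rValueMin_le_iff hq
    (fun x hx hxq => fFun_le_of_le hM hc₂.1 hp₁' hi hc
      ((monotoneOn_mul_c1Tilde hl hc₂ ht).mono Set.Ioo_subset_Ioi_self) hx hq hxq)
    (isLeast_fFun_c1Tilde hl hc₂ ht hm hp₁ hi)

lemma mStar_pos (hm : 0 < m) : 0 < mStar m := by
  refine mul_pos (by exact_mod_cast hm) (Finset.sum_pos (fun j hj => ?_) ⟨1, by simp; omega⟩)
  have : 0 < j := (Finset.mem_Icc.1 hj).1
  positivity

lemma sum_le_harmonicFactor (K : ℕ) :
    ∑ j ∈ Finset.Icc 1 K, 1 / (j : ℝ) ≤ harmonicFactor (K - 1) := by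
  rcases Nat.eq_zero_or_pos K with rfl | hK
  · simp [harmonicFactor]
  obtain ⟨k, rfl⟩ := Nat.exists_eq_succ_of_ne_zero hK.ne'
  rw [Nat.succ_eq_add_one, Finset.sum_Icc_succ_top (by omega), add_comm, harmonicFactor,
    Nat.add_sub_cancel]
  gcongr
  rw [div_le_one (by positivity)]
  simp

lemma rValue_le_one (f : ℝ → ℝ) : rValue f ≤ 1 := by
  unfold rValue
  split_ifs with h
  · exact h.choose_spec.1.2.le
  · exact le_rfl

lemma rValueMin_le_one (f : ℝ → ℝ) : rValueMin f ≤ 1 := by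
  unfold rValueMin
  split_ifs with h
  · have hbdd : BddBelow {x | x ∈ Set.Ioo (0 : ℝ) 1 ∧ f x ≤ x} :=
      ⟨(0 : ℝ), fun y hy => hy.1.1.le⟩
    obtain ⟨x, hx⟩ := h
    exact (csInf_le hbdd hx).trans hx.1.2.le
  · exact le_rfl

end Procedures

section Probability

variable {Ω : Type*} [MeasurableSpace Ω] {μ : Measure Ω} [IsProbabilityMeasure μ] {m : ℕ}
  {N₁ N₂ : Finset (Fin m)} {P₁ P₂ : Fin m → Ω → ℝ} {S : (Fin m → ℝ) → Finset (Fin m)} {q : ℝ}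

lemma NullPValue.map_le {P : Fin m → Ω → ℝ} (hP : ∀ i, Measurable (P i)) {i : Fin m}
    (h : NullPValue μ (P i)) {a : ℝ} (ha : 0 ≤ a) :
    μ.map (fun ω k => P k ω) {p | p i ≤ a} ≤ ENNReal.ofReal a := by
  rw [Measure.map_apply (measurable_pi_lambda _ hP)
    (measurableSet_le (measurable_pi_apply i) measurable_const)]
  rcases le_total a 1 with h1 | h1
  · exact h a ⟨ha, h1⟩
  · exact prob_le_one.trans (by simpa using ENNReal.ofReal_le_ofReal h1)

/-- For `q ≥ 1` all selected features are declared replicated, and only measurability needs a proof.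
The case `m = 0`, where `M = 0` would make the thresholds degenerate, is of the same kind. -/
lemma fdrControlled_trivial (hP₁ : ∀ i, Measurable (P₁ i)) (hS : MeasurableRule S) (hq : 0 < q)
    (h : 1 ≤ q ∨ m = 0) {r : Ω → Fin m → ℝ} (hr : ∀ ω i, r ω i ≤ 1) :
    FDRControlled μ N₁ N₂ (fun ω => declared (selected S P₁ ω) (r ω) q) q := by
  have hD : ∀ ω, declared (selected S P₁ ω) (r ω) q = selected S P₁ ω := by
    intro ω
    rcases h with h | rfl
    · exact Finset.filter_true_of_mem fun i _ => (hr ω i).trans h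
    · exact Subsingleton.elim _ _
  have hle : ∀ D : Finset (Fin m), fdp N₁ N₂ D ≤ q := by
    intro D
    rcases h with h | rfl
    · exact (fdp_le_one _ _ _).trans h
    · rw [Subsingleton.elim D ∅]
      simpa [fdp] using hq.le
  have hint : Integrable (fun ω => fdp N₁ N₂ (selected S P₁ ω)) μ := by
    refine .of_bound (measurable_comp_finset (fun i => ?_) (fdp N₁ N₂)).aestronglyMeasurable 1
      (.of_forall fun ω => ?_)
    · exact measurable_pi_lambda _ hP₁ (hS i)
    · rw [Real.norm_of_nonneg (fdp_nonneg _ _ _)]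
      exact fdp_le_one _ _ _
  simp only [FDRControlled, hD]
  refine ⟨hint, (integral_mono hint (integrable_const q) fun ω => hle _).trans ?_⟩
  simp

/-- Passage from the laws of the two vectors of `p`-values to the probability space. -/
lemma fdrControlled_of_ae_eq (hP₁ : ∀ i, Measurable (P₁ i)) (hP₂ : ∀ i, Measurable (P₂ i))
    (hnull₂ : ∀ i ∈ N₂, NullPValue μ (P₂ i)) (hS : MeasurableRule S)
    {l₀₀ c₂ : ℝ} (hl₀₀ : l₀₀ ∈ Set.Ico (0 : ℝ) 1) (hc₂ : c₂ ∈ Set.Ioo (0 : ℝ) 1)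
    (hl : l₀₀ ≤ ((N₁ ∩ N₂).card : ℝ) / (m : ℝ))
    (hdep : iIndepFun P₂ μ ∨ PRDS μ P₂ N₂)
    (hindep : IndepFun (fun ω i => P₁ i ω) (fun ω i => P₂ i ω) μ)
    (hq : q ∈ Set.Ioo (0 : ℝ) 1) (hm : 0 < m) {α : ℝ} (hα : 0 ≤ α)
    (h₁ : ∀ i ∈ N₁, ∀ p₂, ∫⁻ p₁, ENNReal.ofReal
      (weight (twoStudyRejection S α (c₂ * q) p₁ p₂) i) ∂(μ.map fun ω k => P₁ k ω) ≤
        ENNReal.ofReal (q * c1 l₀₀ c₂ q / m))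
    {D : Ω → Finset (Fin m)} (hD : ∀ᵐ ω ∂μ, D ω =
      twoStudyRejection S α (c₂ * q) (fun k => P₁ k ω) (fun k => P₂ k ω)) :
    FDRControlled μ N₁ N₂ D q := by
  have hP₁m : Measurable fun ω k => P₁ k ω := measurable_pi_lambda _ hP₁
  have hP₂m : Measurable fun ω k => P₂ k ω := measurable_pi_lambda _ hP₂
  have := Measure.isProbabilityMeasure_map (μ := μ) hP₁m.aemeasurable
  have := Measure.isProbabilityMeasure_map (μ := μ) hP₂m.aemeasurable
  have hb : 0 ≤ c₂ * q := (mul_pos hc₂.1 hq.1).le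
  have hdep' : ∀ i ∈ N₂, ConditionallyIncreasing (μ.map fun ω k => P₂ k ω) i := by
    intro i hi
    rcases hdep with h | h
    · rw [(iIndepFun_iff_map_fun_eq_pi_map fun j => (hP₂ j).aemeasurable).1 h]
      have := fun j => Measure.isProbabilityMeasure_map (μ := μ) (hP₂ j).aemeasurable
      exact conditionallyIncreasing_pi _ i
    · exact h.conditionallyIncreasing hP₂ hi
  have hγ : 0 ≤ q * c1 l₀₀ c₂ q / m :=
    div_nonneg (mul_pos hq.1 (c1_pos hl₀₀ hc₂ hq.1)).le (Nat.cast_nonneg m)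
  have hbound := (lintegral_fdp_le hS hα hb hγ h₁
    (fun i hi a ha => (hnull₂ i hi).map_le hP₂ ha) hdep').trans
    (ENNReal.ofReal_le_ofReal (fdr_bound_le hl₀₀ hc₂ hq hm hl))
  have hpair : Measurable fun ω => ((fun k => P₁ k ω), fun k => P₂ k ω) := hP₁m.prodMk hP₂m
  have hfdp : Measurable fun z : (Fin m → ℝ) × (Fin m → ℝ) =>
      fdp N₁ N₂ (twoStudyRejection S α (c₂ * q) z.1 z.2) :=
    measurable_comp_finset (measurableSet_mem_twoStudyRejection hS) (fdp N₁ N₂)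
  rw [← (indepFun_iff_map_prod_eq_prod_map_map hP₁m.aemeasurable hP₂m.aemeasurable).1 hindep,
    lintegral_map hfdp.ennreal_ofReal hpair] at hbound
  have hcongr : (fun ω => fdp N₁ N₂ (twoStudyRejection S α (c₂ * q) (fun k => P₁ k ω)
      fun k => P₂ k ω)) =ᵐ[μ] fun ω => fdp N₁ N₂ (D ω) := by
    filter_upwards [hD] with ω hω
    rw [hω]
  have hmeas : Measurable fun ω => fdp N₁ N₂ (twoStudyRejection S α (c₂ * q) (fun k => P₁ k ω)
      fun k => P₂ k ω) := by
    simpa only [Function.comp_def] using hfdp.comp hpair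
  refine ⟨Integrable.congr (.of_bound hmeas.aestronglyMeasurable 1 (.of_forall fun ω => ?_)) hcongr,
    ?_⟩
  · rw [Real.norm_of_nonneg (fdp_nonneg _ _ _)]
    exact fdp_le_one _ _ _
  · rw [← integral_congr_ae hcongr, integral_eq_lintegral_of_nonneg_ae
      (.of_forall fun ω => fdp_nonneg _ _ _) hmeas.aestronglyMeasurable]
    exact ENNReal.toReal_le_of_le_ofReal hq.1.le hbound

end Probability

end Replicability

theorem theorem1 {Ω : Type*} [MeasurableSpace Ω] (μ : Measure Ω) [IsProbabilityMeasure μ]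
    {m : ℕ}
    -- the sets of features that are null in the primary and in the follow-up study
    (N₁ N₂ : Finset (Fin m))
    -- the p-values of the primary and of the follow-up study
    (P₁ P₂ : Fin m → Ω → ℝ)
    (hP₁ : ∀ i, Measurable (P₁ i)) (hP₂ : ∀ i, Measurable (P₂ i))
    (hP₁_mem : ∀ i, ∀ᵐ ω ∂μ, P₁ i ω ∈ Set.Ioc (0 : ℝ) 1)
    (hP₂_mem : ∀ i, ∀ᵐ ω ∂μ, P₂ i ω ∈ Set.Ioc (0 : ℝ) 1)
    (hnull₁ : ∀ i ∈ N₁, Replicability.NullPValue μ (P₁ i))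
    (hnull₂ : ∀ i ∈ N₂, Replicability.NullPValue μ (P₂ i))
    -- the rule by which the features are selected for follow-up
    (S : (Fin m → ℝ) → Finset (Fin m))
    (hS_meas : Replicability.MeasurableRule S) (hS : Replicability.StableRule S)
    -- the parameters, and the lower bound on the fraction of features null in both studies
    (l₀₀ c₂ : ℝ) (hl₀₀ : l₀₀ ∈ Set.Ico (0 : ℝ) 1) (hc₂ : c₂ ∈ Set.Ioo (0 : ℝ) 1)
    (hl : l₀₀ ≤ ((N₁ ∩ N₂).card : ℝ) / (m : ℝ))
    -- dependence within the follow-up study and between the studies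
    (hdep : iIndepFun P₂ μ ∨ Replicability.PRDS μ P₂ N₂)
    (hindep : IndepFun (fun ω i => P₁ i ω) (fun ω i => P₂ i ω) μ)
    (q : ℝ) (hq : 0 < q) :
    -- independence within the primary study
    (iIndepFun P₁ μ →
      (∀ᵐ ω ∂μ, ∀ i ∈ Replicability.selected S P₁ ω,
        {x | x ∈ Set.Ioo (0 : ℝ) 1 ∧ Replicability.fObs S P₁ P₂ m (Replicability.c1 l₀₀ c₂) c₂ ω i x = x}.Subsingleton) ∧
      Replicability.FDRControlled μ N₁ N₂ (fun ω => Replicability.declared (Replicability.selected S P₁ ω)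
        (fun i => Replicability.rValue (Replicability.fObs S P₁ P₂ m (Replicability.c1 l₀₀ c₂) c₂ ω i)) q) q) ∧
    -- arbitrary dependence within the primary study, with `m*` in place of `m`
    ((∀ᵐ ω ∂μ, ∀ i ∈ Replicability.selected S P₁ ω,
        {x | x ∈ Set.Ioo (0 : ℝ) 1 ∧
          Replicability.fObs S P₁ P₂ (Replicability.mStar m) (Replicability.c1 l₀₀ c₂) c₂ ω i x = x}.Subsingleton) ∧
      Replicability.FDRControlled μ N₁ N₂ (fun ω => Replicability.declared (Replicability.selected S P₁ ω)
        (fun i => Replicability.rValue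
          (Replicability.fObs S P₁ P₂ (Replicability.mStar m) (Replicability.c1 l₀₀ c₂) c₂ ω i)) q) q) ∧
    -- arbitrary dependence within the primary study, with selection below a threshold `t`
    (∀ t ∈ Set.Ioo (0 : ℝ) 1,
      (∀ p ∈ Replicability.PVector m, ∀ j ∈ S p, p j ≤ t) →
      (∀ x ∈ Set.Ioo (0 : ℝ) 1, IsGreatest (Replicability.c1TildeSet m t l₀₀ c₂ x)
        (Replicability.c1Tilde m t l₀₀ c₂ x)) ∧
      (∀ᵐ ω ∂μ, ∀ i ∈ Replicability.selected S P₁ ω,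
        (∃ x ∈ Set.Ioo (0 : ℝ) 1, Replicability.fObs S P₁ P₂ m (Replicability.c1Tilde m t l₀₀ c₂) c₂ ω i x ≤ x) →
        IsLeast {x | x ∈ Set.Ioo (0 : ℝ) 1 ∧ Replicability.fObs S P₁ P₂ m (Replicability.c1Tilde m t l₀₀ c₂) c₂ ω i x ≤ x}
          (Replicability.rValueMin (Replicability.fObs S P₁ P₂ m (Replicability.c1Tilde m t l₀₀ c₂) c₂ ω i))) ∧
      Replicability.FDRControlled μ N₁ N₂ (fun ω => Replicability.declared (Replicability.selected S P₁ ω)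
        (fun i => Replicability.rValueMin (Replicability.fObs S P₁ P₂ m (Replicability.c1Tilde m t l₀₀ c₂) c₂ ω i)) q) q) := by
  have hP₁m : Measurable fun ω k => P₁ k ω := measurable_pi_lambda _ hP₁
  have hPV : ∀ᵐ ω ∂μ, (fun k => P₁ k ω) ∈ Replicability.PVector m := ae_all_iff.2 hP₁_mem
  have hbq : 0 ≤ c₂ * q := (mul_pos hc₂.1 hq).le
  refine ⟨fun hind => ⟨?_, ?_⟩, ⟨?_, ?_⟩, fun t ht hsel => ⟨?_, ?_, ?_⟩⟩
  · filter_upwards [hPV] with ω hω i hi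
    have hm : (0 : ℝ) < m := by exact_mod_cast i.pos
    exact Replicability.fFun_c1_subsingleton hl₀₀ hc₂ hm (fun j => (hω j).1) hi
  · by_cases htriv : 1 ≤ q ∨ m = 0
    · exact Replicability.fdrControlled_trivial hP₁ hS_meas hq htriv
        fun ω i => Replicability.rValue_le_one _
    obtain ⟨hq1, hm0⟩ := not_or.1 htriv
    have hqI : q ∈ Set.Ioo (0 : ℝ) 1 := ⟨hq, not_le.1 hq1⟩
    have hm : 0 < m := Nat.pos_of_ne_zero hm0
    have hmr : (0 : ℝ) < m := by exact_mod_cast hm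
    have hα : 0 ≤ q * Replicability.c1 l₀₀ c₂ q / m :=
      div_nonneg (mul_pos hq (Replicability.c1_pos hl₀₀ hc₂ hq)).le hmr.le
    refine Replicability.fdrControlled_of_ae_eq hP₁ hP₂ hnull₂ hS_meas hl₀₀ hc₂ hl hdep hindep
      hqI hm hα (fun i hi p₂ => ?_) ?_
    · have hprob := fun j => Measure.isProbabilityMeasure_map (μ := μ) (hP₁ j).aemeasurable
      rw [(iIndepFun_iff_map_fun_eq_pi_map fun j => (hP₁ j).aemeasurable).1 hind]
      refine Replicability.lintegral_weight_le_of_pi hS_meas hS hα hbq _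
        (fun j => (ae_map_iff (hP₁ j).aemeasurable measurableSet_Ioc).2 (hP₁_mem j))
        (fun a ha => ?_) p₂
      have h := (hnull₁ i hi).map_le hP₁ ha
      rw [Measure.map_apply hP₁m
        (measurableSet_le (measurable_pi_apply i) measurable_const)] at h
      rwa [Measure.map_apply (hP₁ i) measurableSet_Iic]
    · filter_upwards [hPV] with ω hω
      ext i
      rw [Replicability.declared, Finset.mem_filter]
      exact (and_congr_right fun hi => Replicability.rValue_c1_le_iff hl₀₀ hc₂ hmr
        (fun j => (hω j).1) hi hqI).trans
        (and_iff_right_of_imp fun h => Replicability.rejection_subset h)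
  · filter_upwards [hPV] with ω hω i hi
    exact Replicability.fFun_c1_subsingleton hl₀₀ hc₂ (Replicability.mStar_pos i.pos)
      (fun j => (hω j).1) hi
  · by_cases htriv : 1 ≤ q ∨ m = 0
    · exact Replicability.fdrControlled_trivial hP₁ hS_meas hq htriv
        fun ω i => Replicability.rValue_le_one _
    obtain ⟨hq1, hm0⟩ := not_or.1 htriv
    have hqI : q ∈ Set.Ioo (0 : ℝ) 1 := ⟨hq, not_le.1 hq1⟩
    have hm : 0 < m := Nat.pos_of_ne_zero hm0
    have hmr : (0 : ℝ) < m := by exact_mod_cast hm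
    have hM := Replicability.mStar_pos hm
    set α := q * Replicability.c1 l₀₀ c₂ q / Replicability.mStar m with hαdef
    have hα : 0 < α := div_pos (mul_pos hq (Replicability.c1_pos hl₀₀ hc₂ hq)) hM
    refine Replicability.fdrControlled_of_ae_eq hP₁ hP₂ hnull₂ hS_meas hl₀₀ hc₂ hl hdep hindep
      hqI hm hα.le (fun i hi p₂ => ?_) ?_
    · -- a rejected primary `p`-value is at most `m α`, as there are at most `m` rejections
      refine (Replicability.lintegral_weight_le_of_threshold (t := m * α) hα hbq (by positivity)
        (fun a ha => (hnull₁ i hi).map_le hP₁ ha) p₂ (.of_forall fun p₁ hi' => ?_)).trans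
        (le_of_eq ?_)
      · have h := (Replicability.selfConsistent_rejection hα.le (by positivity) i hi').1
        refine h.trans (mul_le_mul_of_nonneg_right ?_ hα.le)
        exact_mod_cast (Finset.card_le_univ _).trans_eq (Fintype.card_fin m)
      · rw [mul_div_cancel_right₀ _ hα.ne', Nat.ceil_natCast, hαdef]
        congr 1
        have hH : (∑ j ∈ Finset.Icc 1 m, 1 / (j : ℝ)) ≠ 0 := fun h => by
          rw [Replicability.mStar, h, mul_zero] at hM
          exact hM.false
        rw [Replicability.mStar]
        field_simp
    · filter_upwards [hPV] with ω hω
      ext i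
      rw [Replicability.declared, Finset.mem_filter]
      exact (and_congr_right fun hi => Replicability.rValue_c1_le_iff hl₀₀ hc₂ hM
        (fun j => (hω j).1) hi hqI).trans
        (and_iff_right_of_imp fun h => Replicability.rejection_subset h)
  · exact fun x hx => (Replicability.c1Tilde_spec hl₀₀ hc₂ ht.1.le hx.1).1
  · filter_upwards [hPV] with ω hω i hi hex
    unfold Replicability.rValueMin
    rw [if_pos hex]
    exact Replicability.isLeast_fFun_c1Tilde hl₀₀ hc₂ ht.1.le i.pos (fun j => (hω j).1) hi hex
  · by_cases htriv : 1 ≤ q ∨ m = 0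
    · exact Replicability.fdrControlled_trivial hP₁ hS_meas hq htriv
        fun ω i => Replicability.rValueMin_le_one _
    obtain ⟨hq1, hm0⟩ := not_or.1 htriv
    have hqI : q ∈ Set.Ioo (0 : ℝ) 1 := ⟨hq, not_le.1 hq1⟩
    have hm : 0 < m := Nat.pos_of_ne_zero hm0
    have hmr : (0 : ℝ) < m := by exact_mod_cast hm
    have hc := (Replicability.c1Tilde_spec (m := m) hl₀₀ hc₂ ht.1.le hq).2.1
    set φ := q * Replicability.c1Tilde m t l₀₀ c₂ q with hφ
    have hφpos : 0 < φ := mul_pos hq hc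
    have hα : 0 < φ / m := div_pos hφpos hmr
    refine Replicability.fdrControlled_of_ae_eq hP₁ hP₂ hnull₂ hS_meas hl₀₀ hc₂ hl hdep hindep
      hqI hm hα.le (fun i hi p₂ => ?_) ?_
    · refine (Replicability.lintegral_weight_le_of_threshold (t := t) hα hbq ht.1
        (fun a ha => (hnull₁ i hi).map_le hP₁ ha) p₂ ?_).trans (ENNReal.ofReal_le_ofReal ?_)
      · have hPV' : ∀ᵐ p ∂(μ.map fun ω k => P₁ k ω), p ∈ Replicability.PVector m :=
          ae_all_iff.2 fun j => (ae_map_iff hP₁m.aemeasurable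
            (measurable_pi_apply j measurableSet_Ioc)).2 (hP₁_mem j)
        filter_upwards [hPV'] with p hp hi'
        exact hsel p hp i (Replicability.rejection_subset hi')
      · -- the defining equation of `c̃₁(q)`, which has the harmonic sum up to `⌈t m / φ - 1⌉`
        have hspec := Replicability.thresholdFun_c1Tilde (m := m) hl₀₀ hc₂ ht.1.le hq
        rw [← hspec, Replicability.thresholdFun_eq, ← hφ, Nat.ceil_sub_one, div_div_eq_mul_div,
          show ∀ H : ℝ, φ * H / m = φ / m * H from fun H => by ring]
        exact mul_le_mul_of_nonneg_left (Replicability.sum_le_harmonicFactor _) hα.le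
    · filter_upwards [hPV] with ω hω
      ext i
      rw [Replicability.declared, Finset.mem_filter]
      exact (and_congr_right fun hi => Replicability.rValueMin_c1Tilde_le_iff hl₀₀ hc₂ ht.1.le hm
        (fun j => (hω j).1) hi hqI).trans
        (and_iff_right_of_imp fun h => Replicability.rejection_subset h)
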